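/- Let $\Sigma$ be a finite alphabet, let $L\subseteq\Sigma^*$ be an arbitrary language, and let $0<\varepsilon<\frac12$. A *1PFA verifier with two provers* is a probabilistic finite automaton without work tape and with arbitrary real transition probabilities, whose read-only input tape contains the input $w$ between a left and a right end-marker, and whose input head starts on the left end-marker, may stay or move right in each step, and never moves to the left or beyond the right end-marker. Its finite state set consists of reading states (among them the initial state), communicating states, and the two halting states "accept" and "reject". In a reading state, the next state and the head move are chosen at random, depending on the state and the scanned symbol. In a communicating state $s$, it sends a symbol $\tau_{s1}$ to the first and a symbol $\tau_{s2}$ to the second prover, receives from them the symbols $\tau_1$ and $\tau_2$ of the same finite communication alphabet, and enters the state $\delta_c(s,\tau_1,\tau_2)$. Each (computationally unlimited) prover sees only the input and the symbols that the verifier has sent to it, neither the coin tosses of the verifier nor the communication with the other prover. Then $L$ has an interactive proof system with two provers and error bound $\varepsilon$ whose verifier is a 1PFA, in both models of two provers: 1. (Multi-prover model.) There are a 1PFA verifier $V$ and provers $P_1,P_2$ such that every $w\in L$ is accepted by $V$ with probability at least $1-\varepsilon$ when it communicates with $P_1,P_2$, and every $w\notin L$ is rejected by $V$ with probability at least $1-\varepsilon$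 when it communicates with any provers $P_1^*,P_2^*$. 2. (Noisy-oracle model.) There are a 1PFA verifier $V$ and provers $P_1,P_2$ such that on every $w\in\Sigma^*$, when $V$ communicates with $P_1$ and any prover $P_2^*$, or with any prover $P_1^*$ and $P_2$, it accepts with probability at least $1-\varepsilon$ if $w\in L$, and rejects with probability at least $1-\varepsilon$ if $w\notin L$. -/

import Mathlib

open scoped ENNReal

namespace TwoProverIPS

/-- Symbols on the read-only input tape: the two end-markers and the letters of the input. -/
inductive TapeSymbol (α : Type*) where
  | leftEnd : TapeSymbol α
  | letter (a : α) : TapeSymbol α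
  | rightEnd : TapeSymbol α

/-- The input `w`, surrounded by the two end-markers: the left end-marker is in cell `0`, the
letters are in cells `1, …, |w|`, and the right end-marker is in cell `|w| + 1`. -/
def tapeAt {α : Type*} (w : List α) : ℕ → TapeSymbol α
  | 0 => TapeSymbol.leftEnd
  | i + 1 =>
    match w[i]? with
    | some a => TapeSymbol.letter a
    | none => TapeSymbol.rightEnd

/-- Moves of a one-way input head: it never moves to the left. -/
inductive Move where
  | stay : Move
  | right : Move

/-- The head position after a move. -/
def Move.apply : Move → ℕ → ℕ
  | Move.stay, i => i
  | Move.right, i => i + 1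

/-- The states of a verifier: reading states, communicating states, and the two halting states. -/
inductive State (R C : Type) where
  | reading (r : R) : State R C
  | communicating (c : C) : State R C
  | accepting : State R C
  | rejecting : State R C

/-- A one-way probabilistic finite automaton (no work tape, arbitrary real transition
probabilities) that communicates with two provers. -/
structure Verifier (α : Type*) where
  /-- the reading states -/
  R : Type
  /-- the communicating states -/
  C : Type
  /-- the communication alphabet -/
  Υ : Type
  [finite_R : Finite R]
  [finite_C : Finite C]
  [finite_Υ : Finite Υ]
  /-- the initial state, a reading state -/
  start : R
  /-- the transition probabilities in a reading state -/
  δr : R → TapeSymbol α → PMF (State R C × Move)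
  /-- the head does not leave the tape through the right end-marker -/
  δr_rightEnd : ∀ (r : R) (s : State R C), δr r TapeSymbol.rightEnd (s, Move.right) = 0
  /-- the symbol that a communicating state writes on the cell shared with the first prover -/
  send₁ : C → Υ
  /-- the symbol that a communicating state writes on the cell shared with the second prover -/
  send₂ : C → Υ
  /-- the next state, given the replies of the two provers -/
  δc : C → Υ → Υ → State R C

/-- A prover sees the input and the symbols that the verifier has written so far on the
communication cell of this prover (oldest first, the current one last), and replies with a symbol.
It does not see the coin tosses of the verifier or the communication with the other prover. -/
def Prover (α Υ : Type*) := List α → List Υ → Υ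

namespace Verifier

variable {α : Type*}

/-- A configuration: the state, the head position, and the lists of the symbols that have been
sent to the first and to the second prover. -/
structure Config (V : Verifier α) where
  state : State V.R V.C
  pos : ℕ
  sent₁ : List V.Υ
  sent₂ : List V.Υ

/-- The initial configuration: the head is on the left end-marker and nothing has been sent. -/
def init (V : Verifier α) : V.Config where
  state := State.reading V.start
  pos := 0
  sent₁ := []
  sent₂ := []

/-- One step of the computation on the input `w` with the provers `P₁` and `P₂`; halting
configurations do not change any more. -/
noncomputable def step (V : Verifier α) (P₁ P₂ : Prover α V.Υ) (w : List α) (c : V.Config) :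
    PMF V.Config :=
  match c.state with
  | State.reading r =>
      (V.δr r (tapeAt w c.pos)).map fun sd =>
        { state := sd.1, pos := sd.2.apply c.pos, sent₁ := c.sent₁, sent₂ := c.sent₂ }
  | State.communicating k =>
      PMF.pure
        { state := V.δc k (P₁ w (c.sent₁ ++ [V.send₁ k])) (P₂ w (c.sent₂ ++ [V.send₂ k]))
          pos := c.pos
          sent₁ := c.sent₁ ++ [V.send₁ k]
          sent₂ := c.sent₂ ++ [V.send₂ k] }
  | State.accepting => PMF.pure c
  | State.rejecting => PMF.pure c

/-- The distribution of the configuration after `n` steps. -/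
noncomputable def run (V : Verifier α) (P₁ P₂ : Prover α V.Υ) (w : List α) : ℕ → PMF V.Config
  | 0 => PMF.pure V.init
  | n + 1 => (run V P₁ P₂ w n).bind (V.step P₁ P₂ w)

/-- The probability that `w` is accepted, that is, that the accepting state is ever entered: the
supremum (and limit) of the nondecreasing probabilities of having accepted within `n` steps. -/
noncomputable def acceptProb (V : Verifier α) (P₁ P₂ : Prover α V.Υ) (w : List α) : ℝ≥0∞ :=
  ⨆ n : ℕ, (V.run P₁ P₂ w n).toOuterMeasure {c | c.state = State.accepting}

/-- The probability that `w` is rejected, that is, that the rejecting state is ever entered. -/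
noncomputable def rejectProb (V : Verifier α) (P₁ P₂ : Prover α V.Υ) (w : List α) : ℝ≥0∞ :=
  ⨆ n : ℕ, (V.run P₁ P₂ w n).toOuterMeasure {c | c.state = State.rejecting}

/-- `V` verifies `L` with error bound `ε` in the multi-prover model (the provers collaborate:
both are honest or both are cheating). Every member is accepted with probability at least `1 - ε`
when `V` communicates with the honest provers, and every non-member is rejected with probability
at least `1 - ε` when `V` communicates with any two provers. -/
def VerifiesMultiProver (V : Verifier α) (L : Language α) (ε : ℝ) : Prop :=
  (∃ P₁ P₂ : Prover α V.Υ, ∀ w ∈ L, ENNReal.ofReal (1 - ε) ≤ V.acceptProb P₁ P₂ w) ∧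
    ∀ w ∉ L, ∀ P₁ P₂ : Prover α V.Υ, ENNReal.ofReal (1 - ε) ≤ V.rejectProb P₁ P₂ w

/-- With probability at least `1 - ε`, the decision of `V` on `w` is the correct one for `L`. -/
def DecidesCorrectly (V : Verifier α) (L : Language α) (ε : ℝ) (P₁ P₂ : Prover α V.Υ)
    (w : List α) : Prop :=
  (w ∈ L → ENNReal.ofReal (1 - ε) ≤ V.acceptProb P₁ P₂ w) ∧
    (w ∉ L → ENNReal.ofReal (1 - ε) ≤ V.rejectProb P₁ P₂ w)

/-- `V` verifies `L` with error bound `ε` in the noisy-oracle model (the provers oppose each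
other: at least one of them, not known to `V`, is honest). On every input, the decision of `V` is
correct with probability at least `1 - ε` whenever at least one of the provers is the honest one,
whatever the other prover does. -/
def VerifiesNoisyOracle (V : Verifier α) (L : Language α) (ε : ℝ) : Prop :=
  ∃ P₁ P₂ : Prover α V.Υ, ∀ w : List α,
    (∀ P₂' : Prover α V.Υ, V.DecidesCorrectly L ε P₁ P₂' w) ∧
      (∀ P₁' : Prover α V.Υ, V.DecidesCorrectly L ε P₁' P₂ w)

end Verifier

end TwoProverIPS

/-! Since transition probabilities are arbitrary reals, one coin can carry the whole language: the
base-4 digits of its bias p are 2 or 1 according to whether the word with the corresponding number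
is in L. Let N be the number of the input and a ≥ N + m. Among 4^(a+N) tosses, the number of heads
differs from p * 4^(a+N) by less than 4^a / 3, except with probability at most 9 / 4^m (Chebyshev).
All digit tails of p lie in [1/3, 2/3], so the digit of weight 4^a in the number of heads is then
exactly the one that decides membership (`digit_of_approx`, `decoder_decides`).

A finite automaton cannot count that far, but a finite control with a queue can. The machine
`decoder` turns the input into a queue of N high and a low cells, reading each letter once, and then
counts tosses and heads in these cells by rotating the queue until the toss counter overflows.

The queue is kept by the provers. Every appended symbol is sent to both of them, and whenever a
symbol is removed, both have to return the message about the new front. A message m with number t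
carries the tag h m + k t. The random function h has a finite domain and fits into the verifier's
memory; the key k t is a one-time pad. The keys are too many to remember, so the message to each
prover contains the next key of the other prover, and the verifier stores only the keys at the front
and the back of the queue. Changing h at a forged message by d and compensating in the pads leaves
the prover's view unchanged; there are |B| such changes with disjoint outcomes, so a wrong reply
gets the right tag with probability at most 1 / |B| (`toOuterMeasure_le_inv_card`, `forgeries_le`).

Without a forgery, the simulation is faithful until a wrong tag exposes the prover that sent it
(`trace_sync`). The verifier then rejects in the multi-prover model, and adopts the other prover's
claim about membership in the noisy-oracle model. Honest provers are never exposed, so this verdict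
is correct in all the required situations, and the total error is at most 9 / 4^m + 2 / |B|. -/

namespace TwoProverIPS

set_option linter.unusedSectionVars false

/-! ### Probability preliminaries -/

/-- A biased coin. -/
noncomputable def coin (p : ℝ) (h0 : 0 ≤ p) (h1 : p ≤ 1) : PMF Bool :=
  PMF.ofFintype (fun b => if b then ENNReal.ofReal p else ENNReal.ofReal (1 - p)) (by
    rw [Fintype.sum_bool]
    simp [← ENNReal.ofReal_add h0 (sub_nonneg.2 h1)])

theorem tsum_bind_mul {S T : Type*} (p : PMF S) (f : S → PMF T) (g : T → ℝ≥0∞) :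
    ∑' y, p.bind f y * g y = ∑' x, p x * ∑' y, f x y * g y := by
  simp_rw [PMF.bind_apply, ← ENNReal.tsum_mul_right, ← ENNReal.tsum_mul_left]
  rw [ENNReal.tsum_comm]
  simp_rw [mul_assoc]

theorem tsum_map_mul {S T : Type*} (p : PMF S) (f : S → T) (g : T → ℝ≥0∞) :
    ∑' y, p.map f y * g y = ∑' x, p x * g (f x) := by
  rw [PMF.map, tsum_bind_mul]
  refine tsum_congr fun x => ?_
  rw [tsum_eq_single (f x)]
  · simp
  · intro y hy
    simp [hy]

theorem toOuterMeasure_eq_tsum {S : Type*} (p : PMF S) (F : Set S) :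
    p.toOuterMeasure F = ∑' x, p x * F.indicator 1 x := by
  rw [PMF.toOuterMeasure_apply]
  refine tsum_congr fun x => ?_
  by_cases h : x ∈ F <;> simp [h]

/-- If the sets `T d '' F` are pairwise disjoint images of `F` under injective
weight-preserving maps, then `F` has probability at most one over the number of maps. -/
theorem toOuterMeasure_le_inv_card {S D : Type*} [Fintype D] [Nonempty D] (μ : PMF S) (F : Set S)
    (T : D → S → S) (hμ : ∀ d, ∀ x ∈ F, μ (T d x) = μ x)
    (hT : ∀ d d', ∀ x ∈ F, ∀ x' ∈ F, T d x = T d' x' → d = d' ∧ x = x') :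
    μ.toOuterMeasure F ≤ (Fintype.card D : ℝ≥0∞)⁻¹ := by
  have hinj : Function.Injective (fun z : D × F => T z.1 z.2) := by
    rintro ⟨d, x, hx⟩ ⟨d', x', hx'⟩ h
    obtain ⟨rfl, rfl⟩ := hT d d' x hx x' hx' h
    rfl
  have h1 : ∑' z : D × F, μ (T z.1 z.2) ≤ 1 :=
    (ENNReal.tsum_comp_le_tsum_of_injective hinj μ).trans μ.tsum_coe.le
  have h2 : ∑' z : D × F, μ (T z.1 z.2) = Fintype.card D * μ.toOuterMeasure F := by
    rw [ENNReal.tsum_prod (f := fun d (x : F) => μ (T d x)), PMF.toOuterMeasure_apply, ← tsum_subtype F μ, tsum_fintype]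
    rw [Finset.sum_congr rfl (fun d _ => tsum_congr fun x : F => hμ d x x.2)]
    simp
  rw [h2] at h1
  rw [← one_div, ENNReal.le_div_iff_mul_le (by simp) (by simp), mul_comm]
  exact h1

/-- The distribution of a secret with distribution `σ`, together with a sequence whose first `n`
terms are independently distributed according to `ρ`. -/
noncomputable def iidLaw {S X : Type*} [Inhabited X] (σ : PMF S) (ρ : PMF X) :
    ℕ → PMF (S × (ℕ → X))
  | 0 => σ.map fun s => (s, fun _ => default)
  | n + 1 => (iidLaw σ ρ n).bind fun ω => ρ.map fun x => (ω.1, Function.update ω.2 n x)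

-- Filling the terms from n on with `default` keeps the law discrete, so a `PMF` suffices and no
-- infinite product measure is needed.
open Classical in
theorem iidLaw_apply {S X : Type*} [Inhabited X] (σ : PMF S) (ρ : PMF X) (n : ℕ) (s : S)
    (f : ℕ → X) : iidLaw σ ρ n (s, f) =
      if ∀ i, n ≤ i → f i = default then σ s * ∏ i ∈ Finset.range n, ρ (f i) else 0 := by
  induction n generalizing s f with
  | zero =>
    rw [iidLaw, PMF.map_apply]
    by_cases h : ∀ i, 0 ≤ i → f i = default
    · rw [if_pos h, tsum_eq_single s]
      · have : f = fun _ => default := funext fun i => h i (Nat.zero_le _)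
        simp [this]
      · intro s' hs'
        simp [hs'.symm]
    · rw [if_neg h]
      refine ENNReal.tsum_eq_zero.2 fun s' => if_neg ?_
      rintro h'
      simp only [Prod.mk.injEq] at h'
      exact h fun i _ => by rw [h'.2]
  | succ n ih =>
    -- The only predecessor of positive mass is f with its n-th term reset to the default.
    rw [iidLaw, PMF.bind_apply, tsum_eq_single (s, Function.update f n default)]
    · rw [ih, PMF.map_apply, tsum_eq_single (f n)]
      · have e1 : (∀ i, n ≤ i → Function.update f n default i = default) ↔
            ∀ i, n + 1 ≤ i → f i = default := by
          constructor
          · intro h i hi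
            have := h i (by omega)
            rwa [Function.update_of_ne (by omega)] at this
          · intro h i hi
            rcases eq_or_ne i n with rfl | hne
            · simp
            · rw [Function.update_of_ne hne]
              exact h i (by omega)
        have e2 : ∏ i ∈ Finset.range n, ρ (Function.update f n default i) =
            ∏ i ∈ Finset.range n, ρ (f i) := by
          refine Finset.prod_congr rfl fun i hi => ?_
          rw [Function.update_of_ne (Finset.mem_range.1 hi).ne]
        simp only [e1, e2, Function.update_idem, Function.update_eq_self, if_true,
          Finset.prod_range_succ]
        split_ifs <;> simp [mul_assoc]
      · intro x hx
        refine if_neg fun h => hx ?_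
        simp only [Prod.mk.injEq, Function.update_idem] at h
        have := congrFun h.2 n
        simpa using this.symm
    · rintro ⟨s', g⟩ hne
      rw [mul_eq_zero]
      by_contra hcon
      push Not at hcon
      obtain ⟨h1, h2⟩ := hcon
      rw [ih] at h1
      have hg : ∀ i, n ≤ i → g i = default := by
        by_contra h
        exact h1 (if_neg h)
      rw [← PMF.mem_support_iff, PMF.support_map] at h2
      obtain ⟨x, -, hx⟩ := h2
      simp only [Prod.mk.injEq] at hx
      obtain ⟨rfl, rfl⟩ := hx
      refine hne ?_
      have := hg n le_rfl
      rw [Function.update_idem, ← this, Function.update_eq_self]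

/-- The deviation of the number of heads among the selected coin tosses from its expectation. -/
noncomputable def headsDev (p : ℝ) (I : ℕ → Bool) (n : ℕ) (c : ℕ → Bool) : ℝ :=
  ∑ i ∈ Finset.range n, if I i then (if c i then 1 - p else -p) else 0

/-- A new selected toss has mean deviation zero and is independent of the earlier ones, so the cross
term vanishes and the second moment grows by p * (1 - p), which is at most 1. -/
theorem tsum_iidLaw_headsDev_sq {S X : Type*} [Inhabited X] (σ : PMF S) (ρ : PMF X)
    (toss : X → Bool) {p : ℝ} (h0 : 0 ≤ p) (h1 : p ≤ 1) (hρ : ρ.map toss = coin p h0 h1)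
    (I : ℕ → Bool) (n : ℕ) :
    ∑' ω, iidLaw σ ρ n ω * ENNReal.ofReal (headsDev p I n (fun i => toss (ω.2 i)) ^ 2) ≤
      ENNReal.ofReal (((Finset.range n).filter fun i => I i).card) := by
  induction n with
  | zero => simp [headsDev]
  | succ n ih =>
    rw [iidLaw, tsum_bind_mul]
    have key : ∀ ω : S × (ℕ → X),
        (∑' ω', (ρ.map fun x => (ω.1, Function.update ω.2 n x)) ω' *
          ENNReal.ofReal (headsDev p I (n + 1) (fun i => toss (ω'.2 i)) ^ 2)) ≤
        ENNReal.ofReal (headsDev p I n (fun i => toss (ω.2 i)) ^ 2) +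
          ENNReal.ofReal (if I n then 1 else 0) := by
      rintro ⟨s, f⟩
      rw [tsum_map_mul]
      set z := headsDev p I n (fun i => toss (f i)) with hz
      have e : ∀ x, headsDev p I (n + 1) (fun i => toss (Function.update f n x i)) =
          z + if I n then (if toss x then 1 - p else -p) else 0 := by
        intro x
        rw [headsDev, Finset.sum_range_succ, hz, headsDev, Function.update_self]
        congr 1
        refine Finset.sum_congr rfl fun i hi => ?_
        rw [Function.update_of_ne (Finset.mem_range.1 hi).ne]
      simp_rw [e]
      rw [← tsum_map_mul ρ toss (fun b => ENNReal.ofReal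
        ((z + if I n then (if b then 1 - p else -p) else 0) ^ 2)), hρ, tsum_fintype,
        Fintype.sum_bool]
      simp only [coin, PMF.ofFintype_apply]
      have h1' : 0 ≤ 1 - p := sub_nonneg.2 h1
      simp only [if_true, Bool.false_eq_true, if_false]
      rw [← ENNReal.ofReal_mul h0, ← ENNReal.ofReal_mul h1', ← ENNReal.ofReal_add (by positivity)
        (by positivity), ← ENNReal.ofReal_add (by positivity) (by split_ifs <;> simp)]
      refine ENNReal.ofReal_le_ofReal ?_
      split_ifs
      · nlinarith
      · nlinarith
    refine (ENNReal.tsum_le_tsum fun ω => mul_le_mul_right (key ω) _).trans ?_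
    simp_rw [mul_add]
    rw [ENNReal.tsum_add, ENNReal.tsum_mul_right, PMF.tsum_coe, one_mul]
    refine (add_le_add_left ih _).trans ?_
    rw [← ENNReal.ofReal_add (by positivity) (by split_ifs <;> simp), Finset.range_add_one,
      Finset.filter_insert]
    refine ENNReal.ofReal_le_ofReal ?_
    split_ifs
    · rw [Finset.card_insert_of_notMem (by simp)]
      simp
    · simp

/-- Chebyshev's inequality for coin tosses. -/
theorem iidLaw_headsDev_le {S X : Type*} [Inhabited X] (σ : PMF S) (ρ : PMF X)
    (toss : X → Bool) {p : ℝ} (h0 : 0 ≤ p) (h1 : p ≤ 1) (hρ : ρ.map toss = coin p h0 h1)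
    (I : ℕ → Bool) (n : ℕ) {a : ℝ} (ha : 0 < a) :
    (iidLaw σ ρ n).toOuterMeasure {ω | a ≤ |headsDev p I n (fun i => toss (ω.2 i))|} ≤
      ENNReal.ofReal (((Finset.range n).filter fun i => I i).card / a ^ 2) := by
  rw [ENNReal.ofReal_div_of_pos (by positivity), ENNReal.le_div_iff_mul_le
    (Or.inl (by simpa using ha.ne')) (Or.inl ENNReal.ofReal_ne_top)]
  refine le_trans ?_ (tsum_iidLaw_headsDev_sq σ ρ toss h0 h1 hρ I n)
  rw [toOuterMeasure_eq_tsum, ← ENNReal.tsum_mul_right]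
  refine ENNReal.tsum_le_tsum fun ω => ?_
  rw [mul_assoc]
  refine mul_le_mul_right ?_ _
  by_cases h : a ≤ |headsDev p I n (fun i => toss (ω.2 i))|
  · rw [Set.indicator_of_mem (by exact h), Pi.one_apply, one_mul]
    refine ENNReal.ofReal_le_ofReal ?_
    rw [← sq_abs (headsDev _ _ _ _)]
    gcongr
  · rw [Set.indicator_of_notMem (by exact h), zero_mul]
    exact zero_le

/-! ### Queue machines -/

/-- The right end-marker stops the head. -/
def Move.guard {α : Type*} : TapeSymbol α → Move → Move
  | TapeSymbol.rightEnd, _ => Move.stay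
  | _, m => m

/-- A finite control with a queue, a coin and a one-way input head. Depending on the control state,
the front symbol of the queue, the scanned symbol and a coin toss, the machine halts with a verdict,
or it changes its state, appends a symbol to the queue, possibly removes the front symbol, and
possibly moves its head. Initially the queue consists of `blank`. -/
structure QueueMachine (α : Type*) (Q Γ : Type) where
  start : Q
  blank : Γ
  δ : Q → Γ → TapeSymbol α → Bool → Bool ⊕ (Q × Γ × Bool × Move)

namespace QueueMachine

variable {α : Type*} {Q Γ : Type}

/-- A configuration: the verdict or the control state, the list of operations performed on the queue
(with the appended symbol and whether the front symbol was removed), and the head position. -/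
structure Cfg (Q Γ : Type) where
  st : Bool ⊕ Q
  log : List (Bool × Γ)
  pos : ℕ

/-- The number of symbols removed from the queue. -/
def pops (log : List (Bool × Γ)) : ℕ := log.countP (·.1)

/-- The contents of the queue. -/
def queue (M : QueueMachine α Q Γ) (log : List (Bool × Γ)) : List Γ :=
  (M.blank :: log.map (·.2)).drop (pops log)

/-- The front symbol of the queue. -/
def hand (M : QueueMachine α Q Γ) (log : List (Bool × Γ)) : Γ :=
  (M.blank :: log.map (·.2)).getD (pops log) M.blank

/-- The next control state, queue operation, and head position. -/
def next (M : QueueMachine α Q Γ) (w : List α) (x : Cfg Q Γ) (c : Bool) :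
    (Bool ⊕ Q) × (Bool × Γ) × ℕ :=
  match x.st with
  | Sum.inl b => (Sum.inl b, (false, M.blank), x.pos)
  | Sum.inr q =>
    match M.δ q (M.hand x.log) (tapeAt w x.pos) c with
    | Sum.inl b => (Sum.inl b, (false, M.blank), x.pos)
    | Sum.inr (q', y, p, m) =>
      (Sum.inr q', (p, y), (m.guard (tapeAt w x.pos)).apply x.pos)

/-- The computation with the coin tosses `c`. -/
def cfg (M : QueueMachine α Q Γ) (w : List α) (c : ℕ → Bool) : ℕ → Cfg Q Γ
  -- The head starts in cell 1 because the verifier leaves the left end-marker while it draws its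
  -- secret.
  | 0 => ⟨Sum.inr M.start, [], 1⟩
  | t + 1 =>
    ⟨(M.next w (cfg M w c t) (c t)).1, (cfg M w c t).log ++ [(M.next w (cfg M w c t) (c t)).2.1],
      (M.next w (cfg M w c t) (c t)).2.2⟩

/-- The queue operation in step `t`. -/
def emit (M : QueueMachine α Q Γ) (w : List α) (c : ℕ → Bool) (t : ℕ) : Bool × Γ :=
  (M.next w (M.cfg w c t) (c t)).2.1

theorem log_eq (M : QueueMachine α Q Γ) (w : List α) (c : ℕ → Bool) (t : ℕ) :
    (M.cfg w c t).log = (List.range t).map (M.emit w c) := by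
  induction t with
  | zero => rfl
  | succ t ih => rw [cfg, List.range_succ, List.map_append, ih]; rfl

theorem log_succ (M : QueueMachine α Q Γ) (w : List α) (c : ℕ → Bool) (t : ℕ) :
    (M.cfg w c (t + 1)).log = (M.cfg w c t).log ++ [M.emit w c t] := rfl

theorem length_log (M : QueueMachine α Q Γ) (w : List α) (c : ℕ → Bool) (t : ℕ) :
    (M.cfg w c t).log.length = t := by
  simp [log_eq]

theorem pops_le (M : QueueMachine α Q Γ) (w : List α) (c : ℕ → Bool) (t : ℕ) :
    pops (M.cfg w c t).log ≤ t :=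
  List.countP_le_length.trans (M.length_log w c t).le

theorem hand_succ_of_not_pop (M : QueueMachine α Q Γ) (w : List α) (c : ℕ → Bool) (t : ℕ)
    (h : (M.emit w c t).1 = false) :
    M.hand (M.cfg w c (t + 1)).log = M.hand (M.cfg w c t).log := by
  have := M.pops_le w c t
  have h2 : pops (M.cfg w c (t + 1)).log = pops (M.cfg w c t).log := by
    simp [log_succ, pops, h]
  rw [hand, hand, h2, log_succ, List.map_append, ← List.cons_append, List.getD_append]
  simpa [length_log] using Nat.lt_succ_of_le this

theorem pops_succ_of_not_pop (M : QueueMachine α Q Γ) (w : List α) (c : ℕ → Bool) (t : ℕ)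
    (h : (M.emit w c t).1 = false) : pops (M.cfg w c (t + 1)).log = pops (M.cfg w c t).log := by
  simp [log_succ, pops, h]

theorem pops_succ_of_pop (M : QueueMachine α Q Γ) (w : List α) (c : ℕ → Bool) (t : ℕ)
    (h : (M.emit w c t).1 = true) :
    pops (M.cfg w c (t + 1)).log = pops (M.cfg w c t).log + 1 := by
  simp [log_succ, pops, h]

/-- The initial `blank` shifts positions by one: after f earlier removals, the new front is the
symbol appended in step f. It always exists, since every step appends a symbol, including the
current one. -/
theorem hand_succ_of_pop (M : QueueMachine α Q Γ) (w : List α) (c : ℕ → Bool) (t : ℕ)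
    (h : (M.emit w c t).1 = true) :
    M.hand (M.cfg w c (t + 1)).log = (M.emit w c (pops (M.cfg w c t).log)).2 := by
  have := M.pops_le w c t
  rw [hand, pops_succ_of_pop M w c t h, log_eq, List.getD_cons_succ]
  have h3 : pops (M.cfg w c t).log < t + 1 := by omega
  rw [List.getD_eq_getElem _ _ (by simpa using h3)]
  simp

end QueueMachine

/-! ### Authentication of the queue -/

section Authentication

variable {Γ B : Type} [AddCommGroup B]

/-- The message about the `i`-th queue operation: the operation, the next key for the other prover,
and a tag for them. -/
def item (e : ℕ → Bool × Γ) (h : Γ × B → B) (k k' : ℕ → B) (i : ℕ) : Bool × Γ × B × B :=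
  ((e i).1, (e i).2, k' (i + 1), h ((e i).2, k' (i + 1)) + k i)

/-- The messages up to and including the one about the `t`-th queue operation. -/
def items (e : ℕ → Bool × Γ) (h : Γ × B → B) (k k' : ℕ → B) (t : ℕ) : List (Bool × Γ × B × B) :=
  (List.range t).map (item e h k k')

/-- The message about the front of the queue. -/
def echo (x : Γ) (l : List (Bool × Γ × B × B)) : Γ × B × B :=
  (l.getD (l.dropLast.countP (·.1)) (false, x, 0, 0)).2

/-- The number of symbols removed from the queue before step `t`. -/
def front (e : ℕ → Bool × Γ) (t : ℕ) : ℕ := QueueMachine.pops ((List.range t).map e)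

theorem front_le (e : ℕ → Bool × Γ) (t : ℕ) : front e t ≤ t :=
  List.countP_le_length.trans (by simp)

theorem items_succ (e : ℕ → Bool × Γ) (h : Γ × B → B) (k k' : ℕ → B) (t : ℕ) :
    items e h k k' (t + 1) = items e h k k' t ++ [item e h k k' t] := by
  simp [items, List.range_succ]

/-- The last message is about the operation in progress; `dropLast` excludes it, so that only
earlier removals are counted. -/
theorem echo_items (e : ℕ → Bool × Γ) (h : Γ × B → B) (k k' : ℕ → B) (x : Γ) (t : ℕ) :
    echo x (items e h k k' (t + 1)) = (item e h k k' (front e t)).2 := by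
  have h1 : (items e h k k' (t + 1)).dropLast.countP (·.1) = front e t := by
    rw [items_succ, List.dropLast_concat, items, front, QueueMachine.pops, List.countP_map,
      List.countP_map]
    rfl
  have h2 := front_le e t
  rw [echo, h1, items, List.getD_eq_getElem _ _ (by simp; omega)]
  simp

/-- In step `t`, the reply is requested and wrong. -/
def Deviates (P : List (Bool × Γ × B × B) → Bool × Γ × B × B) (e : ℕ → Bool × Γ) (h : Γ × B → B)
    (k k' : ℕ → B) (t : ℕ) : Prop :=
  (e t).1 = true ∧ (P (items e h k k' (t + 1))).2 ≠ (item e h k k' (front e t)).2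

/-- The tag in a reply is the right one for the hash function `h` and the key `κ`. -/
def Authentic (h : Γ × B → B) (κ : B) (r : Bool × Γ × B × B) : Prop :=
  r.2.2.2 = h (r.2.1, r.2.2.1) + κ

/-- The first wrong reply is in step `t`, and its tag is right. -/
def ForgesAt (P : List (Bool × Γ × B × B) → Bool × Γ × B × B) (e : ℕ → Bool × Γ) (h : Γ × B → B)
    (k k' : ℕ → B) (t : ℕ) : Prop :=
  (∀ s < t, ¬ Deviates P e h k k' s) ∧ Deviates P e h k k' t ∧
    Authentic h (k (front e t)) (P (items e h k k' (t + 1)))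

/-- A wrong reply with the right tag has a wrong message part. -/
theorem ForgesAt.message_ne {P : List (Bool × Γ × B × B) → Bool × Γ × B × B} {e : ℕ → Bool × Γ}
    {h : Γ × B → B} {k k' : ℕ → B} {t : ℕ} (H : ForgesAt P e h k k' t) :
    ((P (items e h k k' (t + 1))).2.1, (P (items e h k k' (t + 1))).2.2.1) ≠
      ((e (front e t)).2, k' (front e t + 1)) := by
  intro heq
  obtain ⟨-, hd, ha⟩ := H
  rw [Authentic, heq] at ha
  refine hd.2 ?_
  rw [Prod.mk.injEq] at heq
  exact Prod.ext heq.1 (Prod.ext heq.2 ha)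

end Authentication

/-! ### The randomness of the verifier -/

section Randomness

variable {Γ B : Type}

/-- The secret of the verifier: for each prover, a hash function and the first key. -/
abbrev Secret (Γ B : Type) := (Bool → Γ × B → B) × (Bool → B)

/-- The randomness in one step: a coin toss and the next key for each prover. -/
abbrev Sample (B : Type) := Bool × (Bool → B)

/-- The keys for the two provers. -/
def keyAt (ω : Secret Γ B × (ℕ → Sample B)) : ℕ → Bool → B
  | 0 => ω.1.2
  | t + 1 => (ω.2 t).2

/-- The coin tosses. -/
def tosses (ω : Secret Γ B × (ℕ → Sample B)) (t : ℕ) : Bool := (ω.2 t).1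

variable [Fintype Γ] [DecidableEq Γ] [Fintype B] [DecidableEq B] [AddCommGroup B]

instance : Inhabited (Sample B) := ⟨(false, 0)⟩

noncomputable def secretLaw (Γ B : Type) [Fintype Γ] [DecidableEq Γ] [Fintype B] [DecidableEq B]
    [AddCommGroup B] : PMF (Secret Γ B) :=
  PMF.uniformOfFintype _

noncomputable def sampleLaw (B : Type) [Fintype B] [AddCommGroup B] (p : PMF Bool) :
    PMF (Sample B) :=
  p.bind fun c => (PMF.uniformOfFintype (Bool → B)).map (Prod.mk c)

theorem sampleLaw_apply (p : PMF Bool) (c : Bool) (b : Bool → B) :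
    sampleLaw B p (c, b) = p c * (Fintype.card (Bool → B) : ℝ≥0∞)⁻¹ := by
  rw [sampleLaw, PMF.bind_apply, tsum_eq_single c]
  · rw [PMF.map_apply, tsum_eq_single b]
    · simp
    · intro b' hb
      simp [hb.symm]
  · intro c' hc
    rw [mul_eq_zero]
    right
    rw [PMF.map_apply]
    refine ENNReal.tsum_eq_zero.2 fun b' => if_neg ?_
    simp [hc.symm]

theorem sampleLaw_map_fst (p : PMF Bool) : (sampleLaw B p).map Prod.fst = p := by
  rw [sampleLaw, PMF.map_bind]
  simp only [PMF.map_comp]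
  have : ∀ c : Bool, (Prod.fst ∘ Prod.mk c : (Bool → B) → Bool) = Function.const _ c :=
    fun c => rfl
  simp only [this, PMF.map_const, PMF.bind_pure]

/-- Change the hash function for one prover at one message by `d`, and the keys accordingly, so that
all tags remain the same. -/
def shift (i : Bool) (n : ℕ) (ms : ℕ → Γ × B) (m : Γ × B) (d : B)
    (ω : Secret Γ B × (ℕ → Sample B)) : Secret Γ B × (ℕ → Sample B) :=
  let ε : ℕ → B := fun t => if t < n ∧ ms t = m then d else 0
  ((Function.update ω.1.1 i (Function.update (ω.1.1 i) m (ω.1.1 i m + d)),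
    Function.update ω.1.2 i (ω.1.2 i - ε 0)),
    fun t => ((ω.2 t).1, Function.update (ω.2 t).2 i ((ω.2 t).2 i - ε (t + 1))))

theorem tosses_shift (i : Bool) (n : ℕ) (ms : ℕ → Γ × B) (m : Γ × B) (d : B)
    (ω : Secret Γ B × (ℕ → Sample B)) : tosses (shift i n ms m d ω) = tosses ω := rfl

theorem keyAt_shift_self (i : Bool) (n : ℕ) (ms : ℕ → Γ × B) (m : Γ × B) (d : B)
    (ω : Secret Γ B × (ℕ → Sample B)) (t : ℕ) :
    keyAt (shift i n ms m d ω) t i = keyAt ω t i - if t < n ∧ ms t = m then d else 0 := by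
  cases t <;> simp [keyAt, shift]

theorem keyAt_shift_not (i : Bool) (n : ℕ) (ms : ℕ → Γ × B) (m : Γ × B) (d : B)
    (ω : Secret Γ B × (ℕ → Sample B)) (t : ℕ) :
    keyAt (shift i n ms m d ω) t (!i) = keyAt ω t (!i) := by
  cases t <;> simp [keyAt, shift]

/-- Hash values and keys are uniform, hence invariant under translation, and the coin tosses are
untouched. Only keys with index below n are moved, so the default tail survives. -/
theorem iidLaw_shift (p : PMF Bool) (i : Bool) (n : ℕ) (ms : ℕ → Γ × B) (m : Γ × B) (d : B)
    (ω : Secret Γ B × (ℕ → Sample B)) :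
    iidLaw (secretLaw Γ B) (sampleLaw B p) n (shift i n ms m d ω) =
      iidLaw (secretLaw Γ B) (sampleLaw B p) n ω := by
  obtain ⟨s, f⟩ := ω
  have e1 : (∀ t, n ≤ t → (shift i n ms m d (s, f)).2 t = default) ↔
      ∀ t, n ≤ t → f t = default := by
    refine forall₂_congr fun t ht => ?_
    have : ¬ (t + 1 < n ∧ ms (t + 1) = m) := fun h => by omega
    simp only [shift, this, if_false, sub_zero, Function.update_eq_self]
  classical
  refine (iidLaw_apply _ _ n _ _).trans ((if_congr e1 ?_ rfl).trans (iidLaw_apply _ _ n _ _).symm)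
  refine congrArg₂ _ (by simp [secretLaw]) (Finset.prod_congr rfl fun t _ => ?_)
  exact (sampleLaw_apply p (f t).1 _).trans (sampleLaw_apply p (f t).1 (f t).2).symm

/-- The view of a prover is not changed by `shift`. -/
theorem item_shift (i : Bool) (n : ℕ) (e : ℕ → Bool × Γ) (m : Γ × B) (d : B)
    (ω : Secret Γ B × (ℕ → Sample B)) {t : ℕ} (ht : t < n) :
    let ω' := shift i n (fun s => ((e s).2, keyAt ω (s + 1) (!i))) m d ω
    item e (ω'.1.1 i) (fun t => keyAt ω' t i) (fun t => keyAt ω' t (!i)) t =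
      item e (ω.1.1 i) (fun t => keyAt ω t i) (fun t => keyAt ω t (!i)) t := by
  intro ω'
  simp only [item, ω', keyAt_shift_not, keyAt_shift_self, ht, true_and]
  have : (shift i n (fun s => ((e s).2, keyAt ω (s + 1) (!i))) m d ω).1.1 i =
      Function.update (ω.1.1 i) m (ω.1.1 i m + d) := by simp [shift]
  rw [this]
  -- At the message m the hash gains d and the pad loses d; elsewhere neither changes.
  by_cases hm : ((e t).2, keyAt ω (t + 1) (!i)) = m
  · simp [hm]
  · simp [hm]

/-- Forgeries within the first `n` steps. -/
def forgeries (P : List (Bool × Γ × B × B) → Bool × Γ × B × B) (E : (ℕ → Bool) → ℕ → Bool × Γ)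
    (i : Bool) (n : ℕ) : Set (Secret Γ B × (ℕ → Sample B)) :=
  {ω | ∃ t < n, ForgesAt P (E (tosses ω)) (ω.1.1 i) (fun t => keyAt ω t i)
    (fun t => keyAt ω t (!i)) t}

open Classical in
/-- A forgery succeeds with small probability only. -/
theorem forgeries_le (P : List (Bool × Γ × B × B) → Bool × Γ × B × B)
    (E : (ℕ → Bool) → ℕ → Bool × Γ) (i : Bool) (n : ℕ) (p : PMF Bool) :
    (iidLaw (secretLaw Γ B) (sampleLaw B p) n).toOuterMeasure (forgeries P E i n) ≤
      (Fintype.card B : ℝ≥0∞)⁻¹ := by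
  set view : Secret Γ B × (ℕ → Sample B) → ℕ → List (Bool × Γ × B × B) := fun ω t =>
    items (E (tosses ω)) (ω.1.1 i) (fun t => keyAt ω t i) (fun t => keyAt ω t (!i)) (t + 1)
    with hview
  set time : Secret Γ B × (ℕ → Sample B) → ℕ := fun ω =>
    if h : ω ∈ forgeries P E i n then h.choose else 0 with htime
  have time_spec : ∀ ω ∈ forgeries P E i n, time ω < n ∧
      ForgesAt P (E (tosses ω)) (ω.1.1 i) (fun t => keyAt ω t i)
        (fun t => keyAt ω t (!i)) (time ω) := by
    intro ω h
    simp only [htime, dif_pos h]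
    exact h.choose_spec
  set msg : Secret Γ B × (ℕ → Sample B) → Γ × B := fun ω =>
    ((P (view ω (time ω))).2.1, (P (view ω (time ω))).2.2.1) with hmsg
  set T : B → Secret Γ B × (ℕ → Sample B) → Secret Γ B × (ℕ → Sample B) := fun d ω =>
    shift i n (fun s => ((E (tosses ω) s).2, keyAt ω (s + 1) (!i))) (msg ω) d ω with hT
  -- There is one shift for each d in B. It remains to recover both d and ω from the shifted point.
  refine toOuterMeasure_le_inv_card _ _ T (fun d ω _ => iidLaw_shift _ _ _ _ _ _ _) ?_
  intro d d' ω hω ω' hω' heq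
  have htoss : tosses ω = tosses ω' := by
    have := congrArg tosses heq
    simpa only [hT, tosses_shift] using this
  have hother : ∀ t, keyAt ω t (!i) = keyAt ω' t (!i) := by
    intro t
    have := congrArg (fun x => keyAt x t (!i)) heq
    simpa only [hT, keyAt_shift_not] using this
  have hitem : ∀ t < n, item (E (tosses ω)) (ω.1.1 i) (fun t => keyAt ω t i)
      (fun t => keyAt ω t (!i)) t = item (E (tosses ω')) (ω'.1.1 i) (fun t => keyAt ω' t i)
      (fun t => keyAt ω' t (!i)) t := by
    intro t ht
    have h1 := item_shift i n (E (tosses ω)) (msg ω) d ω ht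
    have h2 := item_shift i n (E (tosses ω')) (msg ω') d' ω' ht
    rw [← h1, ← h2]
    simp only [hT] at heq
    rw [heq, htoss]
  have hitems : ∀ t ≤ n, items (E (tosses ω)) (ω.1.1 i) (fun t => keyAt ω t i)
      (fun t => keyAt ω t (!i)) t = items (E (tosses ω')) (ω'.1.1 i) (fun t => keyAt ω' t i)
      (fun t => keyAt ω' t (!i)) t := by
    intro t ht
    refine List.map_congr_left fun s hs => hitem s ?_
    have := List.mem_range.1 hs
    omega
  have hdev : ∀ t < n, (Deviates P (E (tosses ω)) (ω.1.1 i) (fun t => keyAt ω t i)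
      (fun t => keyAt ω t (!i)) t ↔ Deviates P (E (tosses ω')) (ω'.1.1 i) (fun t => keyAt ω' t i)
      (fun t => keyAt ω' t (!i)) t) := by
    intro t ht
    rw [Deviates, Deviates, hitems (t + 1) (by omega),
      hitem (front (E (tosses ω)) t) ((front_le _ _).trans_lt ht), htoss]
  obtain ⟨hlt, hF⟩ := time_spec ω hω
  obtain ⟨hlt', hF'⟩ := time_spec ω' hω'
  -- The time of the first wrong reply depends only on the tosses and the prover's view, which the
  -- shift preserves.
  have htime_eq : time ω = time ω' := by
    refine le_antisymm (not_lt.1 fun h => ?_) (not_lt.1 fun h => ?_)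
    · exact hF.1 _ h ((hdev _ hlt').2 hF'.2.1)
    · exact hF'.1 _ h ((hdev _ hlt).1 hF.2.1)
  have hview_eq : view ω (time ω) = view ω' (time ω') := by
    rw [← htime_eq]
    exact hitems _ (by omega)
  have hmsg_eq : msg ω = msg ω' := by simp only [hmsg, hview_eq]
  have hhash : ∀ x, Function.update (ω.1.1 i) (msg ω) (ω.1.1 i (msg ω) + d) x =
      Function.update (ω'.1.1 i) (msg ω) (ω'.1.1 i (msg ω) + d') x := by
    intro x
    have := congrArg (fun z => z.1.1 i x) heq
    simpa only [hT, shift, Function.update_self, ← hmsg_eq] using this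
  set j := front (E (tosses ω)) (time ω) with hj
  have hjn : j < n := (front_le _ _).trans_lt hlt
  -- The true message j is not the forged one, so its hash is not shifted and the pad of index j is
  -- the same for ω and ω'. Subtracting this pad from the common forged tag gives the same unshifted
  -- hash of the forged message for both; as the shifted hashes also agree, d = d'.
  have hne : ((E (tosses ω) j).2, keyAt ω (j + 1) (!i)) ≠ msg ω := fun h => hF.message_ne h.symm
  have hh : ω.1.1 i ((E (tosses ω) j).2, keyAt ω (j + 1) (!i)) =
      ω'.1.1 i ((E (tosses ω) j).2, keyAt ω (j + 1) (!i)) := by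
    have := hhash ((E (tosses ω) j).2, keyAt ω (j + 1) (!i))
    rwa [Function.update_of_ne hne, Function.update_of_ne hne] at this
  have hkey : keyAt ω j i = keyAt ω' j i := by
    have := congrArg (fun z => z.2.2.2) (hitem j hjn)
    simp only [item, ← htoss, ← hother, hh] at this
    exact add_left_cancel this
  have ha := hF.2.2
  have ha' := hF'.2.2
  have hd : d = d' := by
    have e1 : (P (view ω (time ω))).2.2.2 = ω.1.1 i (msg ω) + keyAt ω j i := ha
    have e2 : (P (view ω' (time ω'))).2.2.2 = ω'.1.1 i (msg ω') + keyAt ω' j i := by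
      rw [hj, htoss, htime_eq]; exact ha'
    rw [← hview_eq, ← hmsg_eq, e1, ← hkey] at e2
    have e3 := add_right_cancel e2
    have := hhash (msg ω)
    rw [Function.update_self, Function.update_self, e3] at this
    exact add_left_cancel this
  subst hd
  refine ⟨rfl, ?_⟩
  have hhash' : ∀ x, ω.1.1 i x = ω'.1.1 i x := by
    intro x
    have := hhash x
    by_cases hx : x = msg ω
    · subst hx
      rw [Function.update_self, Function.update_self] at this
      exact add_right_cancel this
    · rwa [Function.update_of_ne hx, Function.update_of_ne hx] at this
  have hkeys : ∀ t b, keyAt ω t b = keyAt ω' t b := by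
    intro t b
    rcases Bool.eq_or_eq_not b i with rfl | rfl
    · have := congrArg (fun x => keyAt x t b) heq
      simp only [hT, keyAt_shift_self, ← hmsg_eq, ← htoss, ← hother] at this
      exact sub_left_injective this
    · exact hother t
  have hhashes : ω.1.1 = ω'.1.1 := by
    funext b
    rcases Bool.eq_or_eq_not b i with rfl | rfl
    · exact funext hhash'
    · have := congrArg (fun z => z.1.1 (!i)) heq
      simpa [hT, shift] using this
  refine Prod.ext (Prod.ext hhashes (funext (hkeys 0))) (funext fun t => Prod.ext ?_ ?_)
  · exact congrFun htoss t
  · exact funext (hkeys (t + 1))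

end Randomness

theorem Verifier.run_zero {α : Type*} (V : Verifier α) (P₁ P₂ : Prover α V.Υ) (w : List α) :
    V.run P₁ P₂ w 0 = PMF.pure V.init := rfl

theorem Verifier.run_succ {α : Type*} (V : Verifier α) (P₁ P₂ : Prover α V.Υ) (w : List α) (n : ℕ) :
    V.run P₁ P₂ w (n + 1) = (V.run P₁ P₂ w n).bind (V.step P₁ P₂ w) := rfl

/-! ### The verifier that simulates a queue machine -/

/-- The memory of the verifier: the control state and the front symbol of the simulated machine,
and for each prover the hash function and the keys of the front and the back of the queue. -/
structure Mem (Q Γ B : Type) where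
  ctl : Q
  hand : Γ
  hash : Bool → Γ × B → B
  front : Bool → B
  back : Bool → B

instance {Q Γ B : Type} [Finite Q] [Finite Γ] [Finite B] : Finite (Mem Q Γ B) :=
  Finite.of_injective (fun m => (m.ctl, m.hand, m.hash, m.front, m.back)) (by
    rintro ⟨⟩ ⟨⟩ h
    simpa using h)

/-- A halting state. -/
def verdict {R C : Type} (b : Bool) : State R C := if b then State.accepting else State.rejecting

namespace QueueMachine

variable {α : Type*} {Q Γ B : Type} [Finite Q] [Fintype Γ] [DecidableEq Γ] [Fintype B]
  [DecidableEq B] [AddCommGroup B]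

/-- The effect of a reading step. A communicating state consists of the memory, the appended symbol,
whether the front symbol is removed, and the next keys. -/
def read (M : QueueMachine α Q Γ) (m : Mem Q Γ B) (a : TapeSymbol α) (x : Sample B) :
    State (Option (Mem Q Γ B)) (Mem Q Γ B × (Bool × Γ) × (Bool → B)) × Move :=
  match M.δ m.ctl m.hand a x.1 with
  | Sum.inl b => (verdict b, Move.stay)
  | Sum.inr (q, y, p, v) => (State.communicating ({ m with ctl := q }, (p, y), x.2), v.guard a)

/-- The message to the prover `i`. -/
def send (i : Bool) (c : Mem Q Γ B × (Bool × Γ) × (Bool → B)) : Bool × Γ × B × B :=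
  (c.2.1.1, c.2.1.2, c.2.2 (!i), c.1.hash i (c.2.1.2, c.2.2 (!i)) + c.1.back i)

/-- The reaction to the replies `r`. When a reply is not authentic, then the verifier
follows the claim of the other prover if `trust` holds, and rejects otherwise. -/
def receive (trust : Bool) (c : Mem Q Γ B × (Bool × Γ) × (Bool → B))
    (r : Bool → Bool × Γ × B × B) :
    State (Option (Mem Q Γ B)) (Mem Q Γ B × (Bool × Γ) × (Bool → B)) :=
  let m := c.1
  if c.2.1.1 then
    if (r false).2.2.2 = m.hash false ((r false).2.1, (r false).2.2.1) + m.front false then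
      if (r true).2.2.2 = m.hash true ((r true).2.1, (r true).2.2.1) + m.front true then
        State.reading (some { m with
          hand := (r false).2.1
          front := fun i => (r (!i)).2.2.1
          back := c.2.2 })
      else verdict (trust && (r false).1)
    else verdict (trust && (r true).1)
  else State.reading (some { m with back := c.2.2 })

/-- The initial memory. -/
def initMem (M : QueueMachine α Q Γ) (s : Secret Γ B) : Mem Q Γ B :=
  ⟨M.start, M.blank, s.1, s.2, s.2⟩

/-- The transitions of the verifier in the reading states; `none` is the initial state. -/
noncomputable def transition (M : QueueMachine α Q Γ) (p : PMF Bool) :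
    Option (Mem Q Γ B) → TapeSymbol α →
      PMF (State (Option (Mem Q Γ B)) (Mem Q Γ B × (Bool × Γ) × (Bool → B)) × Move)
  | none, a => (secretLaw Γ B).map fun s => (State.reading (some (M.initMem s)), Move.right.guard a)
  | some m, a => (sampleLaw B p).map (M.read m a)

theorem guard_rightEnd (v : Move) : v.guard (TapeSymbol.rightEnd : TapeSymbol α) = Move.stay := by
  cases v <;> rfl

theorem transition_rightEnd (M : QueueMachine α Q Γ) (p : PMF Bool) (r : Option (Mem Q Γ B))
    (s : State (Option (Mem Q Γ B)) (Mem Q Γ B × (Bool × Γ) × (Bool → B))) :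
    M.transition p r TapeSymbol.rightEnd (s, Move.right) = 0 := by
  rw [PMF.apply_eq_zero_iff]
  cases r with
  | none =>
    rw [transition, PMF.support_map]
    rintro ⟨x, -, hx⟩
    simp [guard_rightEnd] at hx
  | some m =>
    rw [transition, PMF.support_map]
    rintro ⟨x, -, hx⟩
    rw [read] at hx
    split at hx <;> simp [guard_rightEnd] at hx

variable (B) in
/-- The verifier that simulates the queue machine `M`. -/
noncomputable abbrev verifier (M : QueueMachine α Q Γ) (p : PMF Bool) (trust : Bool) :
    Verifier α where
  R := Option (Mem Q Γ B)
  C := Mem Q Γ B × (Bool × Γ) × (Bool → B)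
  Υ := Bool × Γ × B × B
  start := none
  δr := M.transition p
  δr_rightEnd := M.transition_rightEnd p
  send₁ := send false
  send₂ := send true
  δc c r₁ r₂ := receive trust c fun i => cond i r₂ r₁

variable (B) in
/-- The honest prover: it says whether the input is in `L`, and returns the message about the front
of the queue. -/
noncomputable def honest (M : QueueMachine α Q Γ) (L : Language α) :
    Prover α (Bool × Γ × B × B) := by
  classical exact fun w l => (decide (w ∈ L), echo M.blank l)

/-! ### Fidelity of the simulation in the absence of forgeries -/

section Simulation

variable (M : QueueMachine α Q Γ) (p : PMF Bool) (trust : Bool)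
  (P₁ P₂ : Prover α (Bool × Γ × B × B)) (w : List α)

/-- The deterministic effect of a communicating step. -/
noncomputable def commStep (c : (M.verifier B p trust).Config) : (M.verifier B p trust).Config :=
  match c.state with
  | State.communicating k =>
    { state := (M.verifier B p trust).δc k (P₁ w (c.sent₁ ++ [send false k]))
        (P₂ w (c.sent₂ ++ [send true k]))
      pos := c.pos
      sent₁ := c.sent₁ ++ [send false k]
      sent₂ := c.sent₂ ++ [send true k] }
  | _ => c

/-- The effect of a reading step followed by a communicating step. -/
noncomputable def cycle (c : (M.verifier B p trust).Config) (x : Sample B) : (M.verifier B p trust).Config :=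
  match c.state with
  | State.reading (some m) =>
    M.commStep p trust P₁ P₂ w
      { c with
        state := (M.read m (tapeAt w c.pos) x).1
        pos := (M.read m (tapeAt w c.pos) x).2.apply c.pos }
  | _ => c

/-- The configuration of the verifier after the initial step and `t` cycles. -/
noncomputable def trace (ω : Secret Γ B × (ℕ → Sample B)) : ℕ → (M.verifier B p trust).Config
  | 0 => ⟨State.reading (some (M.initMem ω.1)), 1, [], []⟩
  | t + 1 => M.cycle p trust P₁ P₂ w (trace ω t) (ω.2 t)

/-- The configurations between two cycles. -/
def Settled (c : (M.verifier B p trust).Config) : Prop :=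
  (∃ m, c.state = State.reading (some m)) ∨ ∃ b, c.state = verdict b

theorem read_fst (m : Mem Q Γ B) (a : TapeSymbol α) (x : Sample B) :
    (∃ k, (M.read m a x).1 = State.communicating k) ∨ ∃ b, (M.read m a x).1 = verdict b := by
  rw [read]
  split
  · exact Or.inr ⟨_, rfl⟩
  · exact Or.inl ⟨_, rfl⟩

theorem receive_settled (c : Mem Q Γ B × (Bool × Γ) × (Bool → B)) (r : Bool → Bool × Γ × B × B) :
    (∃ m, receive trust c r = State.reading (some m)) ∨ ∃ b, receive trust c r = verdict b := by
  rw [receive]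
  split_ifs
  · exact Or.inl ⟨_, rfl⟩
  · exact Or.inr ⟨_, rfl⟩
  · exact Or.inr ⟨_, rfl⟩
  · exact Or.inl ⟨_, rfl⟩

theorem step_of_verdict {c : (M.verifier B p trust).Config} {b : Bool} (h : c.state = verdict b) :
    (M.verifier B p trust).step P₁ P₂ w c = PMF.pure c := by
  cases b <;> (simp only [verdict] at h; simp [Verifier.step, h])

theorem cycle_of_verdict {c : (M.verifier B p trust).Config} {b : Bool} (h : c.state = verdict b)
    (x : Sample B) : M.cycle p trust P₁ P₂ w c x = c := by
  cases b <;> (simp only [verdict] at h; simp [cycle, h])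

theorem step_eq_commStep {c : (M.verifier B p trust).Config}
    (h : (∃ k, c.state = State.communicating k) ∨ ∃ b, c.state = verdict b) :
    (M.verifier B p trust).step P₁ P₂ w c = PMF.pure (M.commStep p trust P₁ P₂ w c) := by
  rcases h with ⟨k, h⟩ | ⟨b, h⟩
  · simp only [Verifier.step, commStep, h]
  · rw [step_of_verdict M p trust P₁ P₂ w h]
    cases b <;> (simp only [verdict] at h; simp [commStep, h])

/-- Halted configurations idle, so a cycle always takes two steps, even if the verdict falls in the
reading step. This keeps all branches in phase and lets each cycle use exactly one sample. -/
theorem step_bind_step {c : (M.verifier B p trust).Config} (h : M.Settled p trust c) :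
    ((M.verifier B p trust).step P₁ P₂ w c).bind ((M.verifier B p trust).step P₁ P₂ w) =
      (sampleLaw B p).map (M.cycle p trust P₁ P₂ w c) := by
  rcases h with ⟨m, h⟩ | ⟨b, h⟩
  · have h1 : (M.verifier B p trust).step P₁ P₂ w c = (sampleLaw B p).map fun x =>
        { c with
          state := (M.read m (tapeAt w c.pos) x).1
          pos := (M.read m (tapeAt w c.pos) x).2.apply c.pos } := by
      simp only [Verifier.step, h]
      change ((sampleLaw B p).map (M.read m (tapeAt w c.pos))).map _ = _
      rw [PMF.map_comp]
      rfl
    rw [h1, PMF.bind_map, PMF.map]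
    congr 1
    funext x
    refine (step_eq_commStep M p trust P₁ P₂ w (M.read_fst m _ x)).trans ?_
    simp only [Function.comp_apply, cycle, h]
  · rw [step_of_verdict M p trust P₁ P₂ w h, PMF.pure_bind, step_of_verdict M p trust P₁ P₂ w h]
    have : M.cycle p trust P₁ P₂ w c = Function.const _ c :=
      funext fun x => cycle_of_verdict M p trust P₁ P₂ w h x
    rw [this, PMF.map_const]

theorem cycle_settled {c : (M.verifier B p trust).Config} (h : M.Settled p trust c)
    (x : Sample B) : M.Settled p trust (M.cycle p trust P₁ P₂ w c x) := by
  rcases h with ⟨m, h⟩ | ⟨b, h⟩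
  · simp only [cycle, h]
    rcases M.read_fst m (tapeAt w c.pos) x with ⟨k, hk⟩ | ⟨b, hb⟩
    · simp only [commStep, hk]
      exact receive_settled (Q := Q) trust k fun i => cond i _ _
    · cases b <;> (simp only [verdict] at hb; simp only [commStep, hb])
      · exact Or.inr ⟨false, rfl⟩
      · exact Or.inr ⟨true, rfl⟩
  · rw [cycle_of_verdict M p trust P₁ P₂ w h]
    exact Or.inr ⟨b, h⟩

theorem trace_settled (ω : Secret Γ B × (ℕ → Sample B)) (t : ℕ) :
    M.Settled p trust (M.trace p trust P₁ P₂ w ω t) := by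
  induction t with
  | zero => exact Or.inl ⟨_, rfl⟩
  | succ t ih => exact M.cycle_settled p trust P₁ P₂ w ih _

theorem trace_update (s : Secret Γ B) (f : ℕ → Sample B) (n : ℕ) (x : Sample B) {t : ℕ}
    (ht : t ≤ n) : M.trace p trust P₁ P₂ w (s, Function.update f n x) t =
      M.trace p trust P₁ P₂ w (s, f) t := by
  induction t with
  | zero => rfl
  | succ t ih =>
    rw [trace, ih (by omega), trace]
    congr 1
    exact Function.update_of_ne (by omega) _ _

/-- The distribution of the configuration of the verifier. -/
theorem run_eq (n : ℕ) : (M.verifier B p trust).run P₁ P₂ w (2 * n + 1) =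
    (iidLaw (secretLaw Γ B) (sampleLaw B p) n).map
      fun ω => M.trace p trust P₁ P₂ w ω n := by
  induction n with
  | zero =>
    rw [Nat.mul_zero, Verifier.run_succ, Verifier.run_zero, PMF.pure_bind, iidLaw, PMF.map_comp]
    change ((secretLaw Γ B).map _).map _ = _
    rw [PMF.map_comp]
    rfl
  | succ n ih =>
    rw [show 2 * (n + 1) + 1 = 2 * n + 1 + 1 + 1 by ring, Verifier.run_succ, Verifier.run_succ, ih,
      PMF.bind_bind, PMF.bind_map, iidLaw, PMF.map_bind]
    congr 1
    funext ω
    rw [Function.comp_apply, step_bind_step M p trust P₁ P₂ w (M.trace_settled p trust P₁ P₂ w ω n),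
      PMF.map_comp]
    congr 1
    funext x
    obtain ⟨s, f⟩ := ω
    rw [Function.comp_apply, trace, trace_update M p trust P₁ P₂ w s f n x le_rfl]
    simp

/-- The reply of the first prover (`false`) or the second prover (`true`). -/
def reply (P₁ P₂ : Prover α (Bool × Γ × B × B)) (w : List α) (i : Bool)
    (l : List (Bool × Γ × B × B)) : Bool × Γ × B × B :=
  cond i (P₂ w l) (P₁ w l)

theorem front_emit (c : ℕ → Bool) (t : ℕ) :
    front (M.emit w c) t = pops (M.cfg w c t).log := by
  rw [front, log_eq]

/-- The configuration of the verifier as long as no prover has given a wrong reply. -/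
noncomputable def syncCfg (ω : Secret Γ B × (ℕ → Sample B)) (t : ℕ) (q : Q) :
    (M.verifier B p trust).Config :=
  let e := M.emit w (tosses ω)
  { state := State.reading (some ⟨q, M.hand (M.cfg w (tosses ω) t).log, ω.1.1,
      keyAt ω (front e t), keyAt ω t⟩)
    pos := (M.cfg w (tosses ω) t).pos
    sent₁ := items e (ω.1.1 false) (fun t => keyAt ω t false) (fun t => keyAt ω t true) t
    sent₂ := items e (ω.1.1 true) (fun t => keyAt ω t true) (fun t => keyAt ω t false) t }

/-- If there is no forgery, then the verifier agrees with the simulated machine, or it has got the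
verdict `b` by detecting a wrong reply. -/
theorem trace_sync {b : Bool}
    (hb : ∀ (i : Bool) (l l' : List (Bool × Γ × B × B)),
      (reply P₁ P₂ w i l).2 ≠ echo M.blank l → (trust && (reply P₁ P₂ w (!i) l').1) = b)
    (ω : Secret Γ B × (ℕ → Sample B)) (n : ℕ)
    (hω : ∀ i, ω ∉ forgeries (reply P₁ P₂ w i) (M.emit w) i n) (t : ℕ) (ht : t ≤ n) :
    (∃ q, (M.cfg w (tosses ω) t).st = Sum.inr q ∧
      M.trace p trust P₁ P₂ w ω t = M.syncCfg p trust w ω t q ∧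
      ∀ i, ∀ s < t, ¬ Deviates (reply P₁ P₂ w i) (M.emit w (tosses ω)) (ω.1.1 i)
        (fun t => keyAt ω t i) (fun t => keyAt ω t (!i)) s) ∨
    (∃ b', (M.cfg w (tosses ω) t).st = Sum.inl b' ∧
      (M.trace p trust P₁ P₂ w ω t).state = verdict b') ∨
    (M.trace p trust P₁ P₂ w ω t).state = verdict b := by
  induction t with
  | zero => exact Or.inl ⟨M.start, rfl, rfl, by simp⟩
  | succ t ih =>
    rcases ih (by omega) with ⟨q, hq, hT, hD⟩ | ⟨b', hq, hT⟩ | hT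
    · set c := tosses ω with hc
      set e := M.emit w c with he
      set x := M.cfg w c t with hx
      cases hδ : M.δ q (M.hand x.log) (tapeAt w x.pos) (c t) with
      | inl b' =>
        refine Or.inr (Or.inl ⟨b', ?_, ?_⟩)
        · simp only [cfg, next, ← hx, hq, hδ]
        · have hr : M.read ⟨q, M.hand x.log, ω.1.1, keyAt ω (front e t), keyAt ω t⟩
              (tapeAt w x.pos) (ω.2 t) = (verdict b', Move.stay) := by
            simp only [read]
            rw [show (ω.2 t).1 = c t from rfl, hδ]
          rw [trace, hT]
          simp only [syncCfg, cycle, ← hc, ← hx, ← he, hr]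
          cases b' <;> rfl
      | inr o =>
        obtain ⟨q', y, pop, v⟩ := o
        have hr : M.read ⟨q, M.hand x.log, ω.1.1, keyAt ω (front e t), keyAt ω t⟩
            (tapeAt w x.pos) (ω.2 t) = (State.communicating
              (⟨q', M.hand x.log, ω.1.1, keyAt ω (front e t), keyAt ω t⟩, (pop, y),
                keyAt ω (t + 1)), v.guard (tapeAt w x.pos)) := by
          simp only [read]
          rw [show (ω.2 t).1 = c t from rfl, hδ]
          rfl
        have het : e t = (pop, y) := by
          simp only [he, emit, next, ← hx, hq, hδ]
        have hst : (M.cfg w c (t + 1)).st = Sum.inr q' := by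
          simp only [cfg, next, ← hx, hq, hδ]
        have hpos : (M.cfg w c (t + 1)).pos = (v.guard (tapeAt w x.pos)).apply x.pos := by
          simp only [cfg, next, ← hx, hq, hδ]
        have hsend : ∀ i, send i (⟨q', M.hand x.log, ω.1.1, keyAt ω (front e t), keyAt ω t⟩,
            (pop, y), keyAt ω (t + 1)) =
            item e (ω.1.1 i) (fun t => keyAt ω t i) (fun t => keyAt ω t (!i)) t := by
          intro i
          simp [send, item, het]
        set r : Bool → Bool × Γ × B × B := fun i => reply P₁ P₂ w i
          (items e (ω.1.1 i) (fun t => keyAt ω t i) (fun t => keyAt ω t (!i)) (t + 1)) with hr'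
        have hstep : M.trace p trust P₁ P₂ w ω (t + 1) =
            { state := receive trust (⟨q', M.hand x.log, ω.1.1, keyAt ω (front e t), keyAt ω t⟩,
                (pop, y), keyAt ω (t + 1)) r
              pos := (M.cfg w c (t + 1)).pos
              sent₁ := items e (ω.1.1 false) (fun t => keyAt ω t false)
                (fun t => keyAt ω t true) (t + 1)
              sent₂ := items e (ω.1.1 true) (fun t => keyAt ω t true)
                (fun t => keyAt ω t false) (t + 1) } := by
          have h1 := hsend false
          have h2 := hsend true
          simp only [Bool.not_false, Bool.not_true] at h1 h2
          rw [trace, hT, hpos]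
          simp only [syncCfg, cycle, ← hc, ← hx, ← he, hr, commStep, h1, h2, items_succ]
          congr 2
          funext i
          cases i <;> simp [hr', items_succ] <;> rfl
        have hecho : ∀ i, (r i).2 ≠ (item e (ω.1.1 i) (fun t => keyAt ω t i)
            (fun t => keyAt ω t (!i)) (front e t)).2 → (trust && (r (!i)).1) = b := by
          intro i hi
          rw [← echo_items e _ _ _ M.blank] at hi
          exact hb i _ _ hi
        -- The stored front keys are still correct here, so a wrong tag proves that the reply
        -- differs from the honest echo, and `hb` applies.
        have hauth : ∀ i, (r i).2.2.2 ≠ ω.1.1 i ((r i).2.1, (r i).2.2.1) + keyAt ω (front e t) i →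
            (trust && (r (!i)).1) = b := by
          intro i hi
          refine hecho i fun h => hi ?_
          rw [h]
          rfl
        cases pop with
        | false =>
          have he1 : (M.emit w c t).1 = false := congrArg Prod.fst het
          refine Or.inl ⟨q', hst, ?_, ?_⟩
          · rw [hstep]
            simp only [syncCfg, receive, ← hc, Bool.false_eq_true, if_false]
            rw [he, front_emit, front_emit, hand_succ_of_not_pop M w c t he1,
              pops_succ_of_not_pop M w c t he1]
          · intro i s hs
            rcases Nat.lt_succ_iff_lt_or_eq.1 hs with hs | rfl
            · exact hD i s hs
            · intro h
              cases h.1.symm.trans he1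
        | true =>
          have he1 : (M.emit w c t).1 = true := congrArg Prod.fst het
          by_cases h1 : (r false).2.2.2 =
            ω.1.1 false ((r false).2.1, (r false).2.2.1) + keyAt ω (front e t) false
          · by_cases h2 : (r true).2.2.2 =
              ω.1.1 true ((r true).2.1, (r true).2.2.1) + keyAt ω (front e t) true
            -- Both tags are right and forgeries are excluded, so both replies are right. They
            -- supply the new front symbol and, crosswise, the next front key for each prover.
            · have hdev : ∀ i, ¬ Deviates (reply P₁ P₂ w i) e (ω.1.1 i)
                  (fun t => keyAt ω t i) (fun t => keyAt ω t (!i)) t := by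
                intro i hi
                refine hω i ⟨t, by omega, hD i, hi, ?_⟩
                cases i
                · exact h1
                · exact h2
              have hrep : ∀ i, (r i).2 = (item e (ω.1.1 i) (fun t => keyAt ω t i)
                  (fun t => keyAt ω t (!i)) (front e t)).2 := by
                intro i
                by_contra h
                exact hdev i ⟨he1, h⟩
              refine Or.inl ⟨q', hst, ?_, ?_⟩
              · rw [hstep]
                have hf : (fun i => (r (!i)).2.2.1) = keyAt ω (front e t + 1) := by
                  funext i
                  rw [hrep (!i)]
                  simp [item]
                have hh : (r false).2.1 = (e (front e t)).2 := by rw [hrep false]; rfl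
                have hrecv : receive trust (⟨q', M.hand x.log, ω.1.1, keyAt ω (front e t),
                    keyAt ω t⟩, (true, y), keyAt ω (t + 1)) r = State.reading (some
                    ⟨q', (r false).2.1, ω.1.1, fun i => (r (!i)).2.2.1, keyAt ω (t + 1)⟩) := by
                  simp only [receive, if_true]
                  rw [if_pos h1, if_pos h2]
                rw [hrecv, hf, hh]
                simp only [syncCfg, ← hc]
                rw [he, front_emit, front_emit, hand_succ_of_pop M w c t he1,
                  pops_succ_of_pop M w c t he1]
              · intro i s hs
                rcases Nat.lt_succ_iff_lt_or_eq.1 hs with hs | rfl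
                · exact hD i s hs
                · exact hdev i
            · refine Or.inr (Or.inr ?_)
              rw [hstep]
              simp only [receive, if_true, if_pos h1, if_neg h2]
              rw [show (trust && (r false).1) = b from hauth true h2]
          · refine Or.inr (Or.inr ?_)
            rw [hstep]
            simp only [receive, if_true, if_neg h1]
            rw [show (trust && (r true).1) = b from hauth false h1]
    · refine Or.inr (Or.inl ⟨b', ?_, ?_⟩)
      · simp only [cfg, next, hq]
      · rw [trace, cycle_of_verdict M p trust P₁ P₂ w hT, hT]
    · refine Or.inr (Or.inr ?_)
      rw [trace, cycle_of_verdict M p trust P₁ P₂ w hT, hT]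

/-- The verifier gets the verdict `b` almost as often as the simulated machine, if the detection of
a wrong reply always leads to this verdict. -/
theorem toOuterMeasure_verdict_le {b : Bool}
    (hb : ∀ (i : Bool) (l l' : List (Bool × Γ × B × B)),
      (reply P₁ P₂ w i l).2 ≠ echo M.blank l → (trust && (reply P₁ P₂ w (!i) l').1) = b)
    (n : ℕ) :
    (iidLaw (secretLaw Γ B) (sampleLaw B p) n).toOuterMeasure
        {ω | (M.cfg w (tosses ω) n).st = Sum.inl b} ≤
      ((M.verifier B p trust).run P₁ P₂ w (2 * n + 1)).toOuterMeasure {c | c.state = verdict b} +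
        ((Fintype.card B : ℝ≥0∞)⁻¹ + (Fintype.card B : ℝ≥0∞)⁻¹) := by
  rw [run_eq, PMF.toOuterMeasure_map_apply]
  refine le_trans (MeasureTheory.measure_mono (t := _ ∪
    (forgeries (reply P₁ P₂ w false) (M.emit w) false n ∪ forgeries (reply P₁ P₂ w true) (M.emit w) true n)) ?_)
    ((MeasureTheory.measure_union_le _ _).trans (add_le_add_right
      ((MeasureTheory.measure_union_le _ _).trans
        (add_le_add (forgeries_le _ _ _ _ _) (forgeries_le _ _ _ _ _))) _))
  intro ω hω
  by_contra h
  simp only [Set.mem_union, not_or] at h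
  refine h.1 ?_
  have hω' : (M.cfg w (tosses ω) n).st = Sum.inl b := hω
  have := M.trace_sync p trust P₁ P₂ w hb ω n (by
    intro i
    cases i
    · exact h.2.1
    · exact h.2.2) n le_rfl
  rw [hω'] at this
  rcases this with ⟨q, hq, -⟩ | ⟨b', hb', h'⟩ | h'
  · cases hq
  · cases hb'
    exact h'
  · exact h'

end Simulation

end QueueMachine

/-! ### The queue machine that decides a language with the help of a coin -/

namespace QueueMachine

section Steps

variable {α : Type*} {Q Γ : Type} (M : QueueMachine α Q Γ) (w : List α) (c : ℕ → Bool)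

/-- The machine is running in step `t`, with the given control state, queue and head position. -/
def At (t : ℕ) (q : Q) (l : List Γ) (i : ℕ) : Prop :=
  (M.cfg w c t).st = Sum.inr q ∧ M.queue (M.cfg w c t).log = l ∧ (M.cfg w c t).pos = i

variable {M w c}

theorem At.hand_eq {t : ℕ} {q : Q} {x : Γ} {l : List Γ} {i : ℕ} (h : M.At w c t q (x :: l) i) :
    M.hand (M.cfg w c t).log = x := by
  have h2 := h.2.1
  rw [queue] at h2
  have h3 := congrArg List.head? h2
  rw [List.head?_drop] at h3
  rw [hand, List.getD_eq_getElem?_getD, h3]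
  rfl

theorem At.succ {t : ℕ} {q q' : Q} {x y : Γ} {l : List Γ} {i : ℕ} {p : Bool} {v : Move}
    (h : M.At w c t q (x :: l) i) (hδ : M.δ q x (tapeAt w i) (c t) = Sum.inr (q', y, p, v)) :
    M.At w c (t + 1) q' ((if p then l else x :: l) ++ [y]) ((v.guard (tapeAt w i)).apply i) := by
  have hn : M.next w (M.cfg w c t) (c t) =
      (Sum.inr q', (p, y), (v.guard (tapeAt w i)).apply i) := by
    simp only [next, h.1, h.hand_eq, h.2.2, hδ]
  refine ⟨by rw [cfg, hn], ?_, by rw [cfg, hn]⟩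
  have hlog : (M.cfg w c (t + 1)).log = (M.cfg w c t).log ++ [(p, y)] := by rw [cfg, hn]
  have h2 := h.2.1
  have h3 := M.pops_le w c t
  have h4 := M.length_log w c t
  rw [queue] at h2 ⊢
  rw [hlog, List.map_append, ← List.cons_append]
  cases p with
  | false =>
    have e : pops ((M.cfg w c t).log ++ [(false, y)]) = pops (M.cfg w c t).log := by simp [pops]
    rw [e, List.drop_append_of_le_length (by simp [h4]; omega), h2]
    simp
  | true =>
    have e : pops ((M.cfg w c t).log ++ [(true, y)]) = pops (M.cfg w c t).log + 1 := by simp [pops]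
    rw [e, List.drop_append_of_le_length (by simp [h4]; omega), ← List.drop_drop, h2]
    simp

theorem At.halt {t : ℕ} {q : Q} {x : Γ} {l : List Γ} {i : ℕ} {b : Bool}
    (h : M.At w c t q (x :: l) i) (hδ : M.δ q x (tapeAt w i) (c t) = Sum.inl b) :
    (M.cfg w c (t + 1)).st = Sum.inl b := by
  have hn : M.next w (M.cfg w c t) (c t) = (Sum.inl b, (false, M.blank), i) := by
    simp only [next, h.1, h.hand_eq, h.2.2, hδ]
  rw [cfg, hn]

end Steps

end QueueMachine

/-- A cell holds a flag, which tells the high digits from the low ones, and a base-4 digit of the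
number of heads and of the number of tosses. -/
abbrev Cell := Bool × Fin 4 × Fin 4

/-- The control states: creating `m + 1` low cells; loading the input, with the number of high cells
still to be appended and the number of copies of the current cell still to be made; incrementing the
counters, with the carries; and searching for the lowest high digit. -/
inductive Ctl (K m : ℕ) where
  | init (j : Fin (m + 1))
  | load (d i : Fin (K + 1))
  | count (ch ct : Bool)
  | search

instance (K m : ℕ) : Finite (Ctl K m) :=
  Finite.of_injective (β := Fin (m + 1) ⊕ (Fin (K + 1) × Fin (K + 1)) ⊕ (Bool × Bool) ⊕ Unit)
    (fun q => match q with
      | .init j => Sum.inl j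
      | .load d i => Sum.inr (Sum.inl (d, i))
      | .count ch ct => Sum.inr (Sum.inr (Sum.inl (ch, ct)))
      | .search => Sum.inr (Sum.inr (Sum.inr ())))
    (by rintro ⟨⟩ ⟨⟩ h <;> simp_all)

/-- An empty cell for a digit. -/
def zeroCell (high : Bool) : Option Cell := some (high, 0, 0)

/-- The queue machine that computes a number from the input, counts heads among sufficiently many
coin tosses, and tests a digit of the result. The symbol `none` marks the beginning of the list of
the digits, lowest digit first. -/
def decoder {α : Type*} {K : ℕ} (m : ℕ) (code : α → Fin (K + 1)) :
    QueueMachine α (Ctl K m) (Option Cell) where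
  start := .init (Fin.last m)
  blank := none
  δ q x a c :=
    match q, x with
    | .init j, _ => Sum.inr (Fin.cases (.load 1 (Fin.last K)) (fun j => .init j.castSucc) j,
        zeroCell false, false, Move.stay)
    | .load d i, some x =>
      Fin.cases (Sum.inr (.load d (Fin.last K), some x, true, Move.stay))
        (fun i => Sum.inr (.load d i.castSucc, some x, false, Move.stay)) i
    | .load d _, none =>
      Fin.cases
        (match a with
          | .leftEnd => Sum.inl false
          | .letter b => Sum.inr (.load (code b) (Fin.last K), none, true, Move.right)
          | .rightEnd => Sum.inr (.count c true, none, true, Move.stay))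
        (fun d => Sum.inr (.load d.castSucc (Fin.last K), zeroCell true, false, Move.stay)) d
    | .count ch ct, some x => Sum.inr (.count (ch && x.2.1 = 3) (ct && x.2.2 = 3),
        some (x.1, if ch then x.2.1 + 1 else x.2.1, if ct then x.2.2 + 1 else x.2.2), true,
        Move.stay)
    -- A carry out of the head counter is dropped, so heads are counted modulo a power of 4; a carry
    -- out of the toss counter ends the counting.
    | .count _ ct, none =>
      Sum.inr (if ct then .search else .count c true, none, true, Move.stay)
    | .search, some x =>
      if x.1 then Sum.inl (x.2.1 = 2 : Bool) else Sum.inr (.search, some x, true, Move.stay)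
    | .search, none => Sum.inl false

/-! ### Correctness of loading, counting and digit search -/

section Decoder

variable {α : Type*} {K m : ℕ} {code : α → Fin (K + 1)} {w : List α} {c : ℕ → Bool}

theorem stay_guard_apply (a : TapeSymbol α) (i : ℕ) : (Move.stay.guard a).apply i = i := by
  cases a <;> rfl

theorem decoder_init (j : Fin (m + 1)) (t : ℕ) (l : List (Option Cell)) (i : ℕ)
    (h : (decoder m code).At w c t (.init j) (none :: l) i) :
    (decoder m code).At w c (t + (j + 1)) (.load 1 (Fin.last K))
      (none :: (l ++ List.replicate (j + 1) (zeroCell false))) i := by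
  induction j using Fin.induction generalizing t l with
  | zero =>
    have := h.succ rfl
    rw [stay_guard_apply] at this
    simpa using this
  | succ j ih =>
    have := h.succ rfl
    rw [stay_guard_apply] at this
    have := ih (t + 1) (l ++ [zeroCell false]) (by simpa using this)
    convert this using 1
    · simp; ring
    · simp [List.replicate_succ]

theorem decoder_copy (d : Fin (K + 1)) (k : Fin (K + 1)) (t : ℕ) (x : Cell)
    (l : List (Option Cell)) (i : ℕ)
    (h : (decoder m code).At w c t (.load d k) (some x :: l) i) :
    (decoder m code).At w c (t + (k + 1)) (.load d (Fin.last K))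
      (l ++ List.replicate (k + 1) (some x)) i := by
  induction k using Fin.induction generalizing t l with
  | zero =>
    have := h.succ rfl
    rw [stay_guard_apply] at this
    simpa using this
  | succ k ih =>
    have := h.succ rfl
    rw [stay_guard_apply] at this
    have := ih (t + 1) (l ++ [some x]) (by simpa using this)
    convert this using 1
    · simp; ring
    · simp [List.replicate_succ]

theorem decoder_copies (d : Fin (K + 1)) (a t : ℕ) (x : Cell) (l : List (Option Cell)) (i : ℕ)
    (h : (decoder m code).At w c t (.load d (Fin.last K)) (List.replicate a (some x) ++ l) i) :
    (decoder m code).At w c (t + a * (K + 1)) (.load d (Fin.last K))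
      (l ++ List.replicate (a * (K + 1)) (some x)) i := by
  induction a generalizing t l with
  | zero => simpa using h
  | succ a ih =>
    have := decoder_copy d (Fin.last K) t x (List.replicate a (some x) ++ l) i
      (by simpa [List.replicate_succ] using h)
    have := ih (t + (K + 1)) (l ++ List.replicate (K + 1) (some x)) (by simpa using this)
    convert this using 1
    · ring
    · rw [List.append_assoc, List.replicate_append_replicate]
      congr 2
      ring

theorem decoder_grow (d : Fin (K + 1)) (t : ℕ) (l : List (Option Cell)) (i : ℕ)
    (h : (decoder m code).At w c t (.load d (Fin.last K)) (none :: l) i) :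
    (decoder m code).At w c (t + d) (.load 0 (Fin.last K))
      (none :: (l ++ List.replicate d (zeroCell true))) i := by
  induction d using Fin.induction generalizing t l with
  | zero => simpa using h
  | succ d ih =>
    have := h.succ rfl
    rw [stay_guard_apply] at this
    have := ih (t + 1) (l ++ [zeroCell true]) (by simpa using this)
    convert this using 1
    · simp; ring
    · simp [List.replicate_succ]

/-- The cells while the input is being loaded. -/
def loaded (a N : ℕ) : List Cell :=
  List.replicate a (false, 0, 0) ++ List.replicate N (true, 0, 0)

/-- This is one step of Horner's scheme in unary: every cell is replaced by K + 1 copies, and then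
`code b` high cells are appended. Low cells stay in front of high cells. -/
theorem decoder_letter {b : α} {t a N i : ℕ} (hb : tapeAt w i = TapeSymbol.letter b)
    (h : (decoder m code).At w c t (.load 0 (Fin.last K)) (none :: (loaded a N).map some) i) :
    (decoder m code).At w c (t + 1 + a * (K + 1) + N * (K + 1) + code b) (.load 0 (Fin.last K))
      (none :: (loaded (a * (K + 1)) (N * (K + 1) + code b)).map some) (i + 1) := by
  have h1 := h.succ (q' := .load (code b) (Fin.last K)) (y := none) (p := true) (v := Move.right)
    (by rw [hb]; rfl)
  rw [hb, show (Move.right.guard (TapeSymbol.letter b)).apply i = i + 1 from rfl] at h1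
  have h2 := decoder_copies _ a _ (false, 0, 0)
    (List.replicate N (some (true, 0, 0)) ++ [none]) (i + 1) (by simpa [loaded] using h1)
  have h3 := decoder_copies _ N _ (true, 0, 0)
    ([none] ++ List.replicate (a * (K + 1)) (some (false, 0, 0))) (i + 1) (by simpa using h2)
  have h4 := decoder_grow (code b) _ (List.replicate (a * (K + 1)) (some (false, 0, 0)) ++
    List.replicate (N * (K + 1)) (some (true, 0, 0))) (i + 1) (by simpa using h3)
  convert h4 using 1
  simp only [loaded, zeroCell, List.map_append, List.map_replicate, List.append_assoc,
    List.replicate_append_replicate]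

/-- The number of the word `w`. -/
def index (code : α → Fin (K + 1)) (w : List α) : ℕ :=
  w.foldl (fun N a => N * (K + 1) + code a) 1

theorem index_concat (code : α → Fin (K + 1)) (w : List α) (a : α) :
    index code (w ++ [a]) = index code w * (K + 1) + code a := by
  simp [index]

theorem index_pos (code : α → Fin (K + 1)) (w : List α) : 0 < index code w := by
  induction w using List.reverseRecOn with
  | nil => simp [index]
  | append_singleton w a ih => rw [index_concat]; positivity

/-- The value 1 for the empty word acts as a leading digit 1 in base K + 1, so leading zeros are not
lost. With K ≥ 1, every nonempty word has a number above 1. -/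
theorem index_injective (hK : 1 ≤ K) (hcode : Function.Injective code) :
    Function.Injective (index code) := by
  have key : ∀ (w : List α) (a : α), index code (w ++ [a]) ≠ 1 := by
    intro w a
    rw [index_concat]
    have := index_pos code w
    nlinarith
  intro w w' h
  induction w using List.reverseRecOn generalizing w' with
  | nil =>
    rcases List.eq_nil_or_concat w' with rfl | ⟨v, a, rfl⟩
    · rfl
    · rw [List.concat_eq_append] at h
      exact absurd h.symm (key v a)
  | append_singleton w a ih =>
    rcases List.eq_nil_or_concat w' with rfl | ⟨v, a', rfl⟩
    · exact absurd h (key w a)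
    · rw [List.concat_eq_append] at h ⊢
      rw [index_concat, index_concat] at h
      have h1 := congrArg (· % (K + 1)) h
      simp only [Nat.mul_add_mod_of_lt (code a).2, Nat.mul_add_mod_of_lt (code a').2] at h1
      have h3 : code a = code a' := Fin.ext h1
      rw [h3] at h
      have h4 : index code w = index code v :=
        Nat.eq_of_mul_eq_mul_right (Nat.succ_pos K) (Nat.add_right_cancel h)
      rw [ih h4, hcode h3]

theorem tapeAt_lt {j : ℕ} (hj : j < w.length) : tapeAt w (j + 1) = TapeSymbol.letter w[j] := by
  simp [tapeAt, hj]

theorem tapeAt_length : tapeAt w (w.length + 1) = TapeSymbol.rightEnd := by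
  simp [tapeAt]

/-- Loading the input takes the same time for all coin tosses. -/
theorem decoder_load (hK : 1 ≤ K) (hm : 1 ≤ m) (code : α → Fin (K + 1)) (w : List α) :
    ∃ t a, index code w + m ≤ a ∧ ∀ c, (decoder m code).At w c t (.load 0 (Fin.last K))
      (none :: (loaded a (index code w)).map some) (w.length + 1) := by
  suffices H : ∀ j ≤ w.length, ∃ t a, index code (w.take j) + m ≤ a ∧
      ∀ c, (decoder m code).At w c t (.load 0 (Fin.last K))
        (none :: (loaded a (index code (w.take j))).map some) (j + 1) by
    simpa using H w.length le_rfl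
  intro j hj
  induction j with
  | zero =>
    refine ⟨0 + (m + 1) + 1, m + 1, by simp [index, add_comm], fun c => ?_⟩
    have h0 : (decoder m code).At w c 0 (.init (Fin.last m)) [none] 1 := ⟨rfl, rfl, rfl⟩
    have h1 := decoder_init _ _ _ _ h0
    have h2 := decoder_grow 1 _ _ _ h1
    -- For K = 0 the literal 1 would be 0 in `Fin (K + 1)`, and no high cell would be created.
    have e : ((1 : Fin (K + 1)) : ℕ) = 1 := by
      obtain ⟨k, rfl⟩ : ∃ k, K = k + 1 := ⟨K - 1, by omega⟩
      rfl
    rw [e] at h2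
    simpa [loaded, zeroCell, index] using h2
  | succ j ih =>
    obtain ⟨t, a, ha, h⟩ := ih (by omega)
    have hidx : index code (w.take (j + 1)) = index code (w.take j) * (K + 1) + code w[j] := by
      rw [← List.take_concat_get' w j (by omega), index_concat]
    rw [hidx]
    refine ⟨_, _, ?_, fun c => decoder_letter (tapeAt_lt (by omega)) (h c)⟩
    -- The invariant a ≥ N + m survives because (N + m) * (K + 1) exceeds N * (K + 1) + m by K * m,
    -- which covers the added code.
    have h1 : (code w[j] : ℕ) ≤ K * m := (Nat.le_of_lt_succ (code w[j]).2).trans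
      (Nat.le_mul_of_pos_right K hm)
    have h2 := Nat.mul_le_mul_right (K + 1) ha
    linarith

/-- The number with the given digits. -/
def value (f : Cell → Fin 4) (u : List Cell) : ℕ := Nat.ofDigits 4 (u.map fun x => (f x : ℕ))

theorem value_cons (f : Cell → Fin 4) (x : Cell) (u : List Cell) :
    value f (x :: u) = f x + 4 * value f u := by
  simp [value, Nat.ofDigits_cons]

theorem value_append (f : Cell → Fin 4) (u v : List Cell) :
    value f (u ++ v) = value f u + 4 ^ u.length * value f v := by
  simp [value, Nat.ofDigits_append]

theorem value_lt (f : Cell → Fin 4) (u : List Cell) : value f u < 4 ^ u.length := by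
  have := Nat.ofDigits_lt_base_pow_length (b := 4) (l := u.map fun x => (f x : ℕ)) (by norm_num)
    (by simp only [List.mem_map]; rintro _ ⟨x, -, rfl⟩; exact (f x).2)
  simpa [value] using this

theorem value_loaded (f : Cell → Fin 4) (hf : ∀ b, f (b, 0, 0) = 0) (a N : ℕ) :
    value f (loaded a N) = 0 := by
  have : ∀ u : List Cell, (∀ x ∈ u, f x = 0) → value f u = 0 := by
    intro u
    induction u with
    | nil => simp [value]
    | cons x u ih =>
      intro h
      rw [value_cons, h x (by simp), ih fun y hy => h y (by simp [hy])]
      rfl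
  refine this _ fun x hx => ?_
  simp only [loaded, List.mem_append, List.mem_replicate] at hx
  rcases hx with ⟨-, rfl⟩ | ⟨-, rfl⟩ <;> exact hf _

theorem carry (b : Bool) (x : Fin 4) :
    ((if b then x + 1 else x : Fin 4) : ℕ) + 4 * (b && x = 3 : Bool).toNat = x + b.toNat := by
  revert b x
  decide

/-- One pass over the digits increments the counters. -/
theorem decoder_pass (u : List Cell) (v : List (Option Cell)) (ch ct : Bool) (t i : ℕ)
    (h : (decoder m code).At w c t (.count ch ct) (u.map some ++ v) i) :
    ∃ u' ch' ct', (decoder m code).At w c (t + u.length) (.count ch' ct') (v ++ u'.map some) i ∧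
      u'.map (·.1) = u.map (·.1) ∧
      value (·.2.1) u' + 4 ^ u.length * ch'.toNat = value (·.2.1) u + ch.toNat ∧
      value (·.2.2) u' + 4 ^ u.length * ct'.toNat = value (·.2.2) u + ct.toNat := by
  induction u generalizing v ch ct t with
  | nil => exact ⟨[], ch, ct, by simpa using h, rfl, by simp [value], by simp [value]⟩
  | cons x u ih =>
    have h1 := h.succ rfl
    rw [stay_guard_apply] at h1
    obtain ⟨u', ch', ct', h2, h3, h4, h5⟩ := ih (v ++ [_]) _ _ _ (by simpa using h1)
    refine ⟨(x.1, if ch then x.2.1 + 1 else x.2.1, if ct then x.2.2 + 1 else x.2.2) :: u', ch', ct',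
      ?_, ?_, ?_, ?_⟩
    · convert h2 using 1
      · simp; ring
      · simp
    · simp [h3]
    · have := carry ch x.2.1
      rw [value_cons, value_cons, List.length_cons, pow_succ]
      linear_combination this + 4 * h4
    · have := carry ct x.2.2
      rw [value_cons, value_cons, List.length_cons, pow_succ]
      linear_combination this + 4 * h5

/-- The number of heads among the first `f` coin tosses that are counted. -/
def heads (c : ℕ → Bool) (t ℓ f : ℕ) : ℕ := ∑ g ∈ Finset.range f, (c (t + g * (ℓ + 1))).toNat

/-- The state is described just after the marker has been rotated: f tosses are in the counters and
the next one is pending as a carry. A pass handles a + N cells and the marker, hence the spacing a +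
N + 1 of the counted tosses. The bound on f excludes an overflow of the toss counter. -/
theorem decoder_count {t a N : ℕ}
    (h : (decoder m code).At w c t (.load 0 (Fin.last K)) (none :: (loaded a N).map some)
      (w.length + 1)) (f : ℕ) (hf : f < 4 ^ (a + N)) :
    ∃ u, (decoder m code).At w c (t + f * (a + N + 1) + 1)
      (.count (c (t + f * (a + N + 1))) true) (u.map some ++ [none]) (w.length + 1) ∧
      u.map (·.1) = (loaded a N).map (·.1) ∧ value (·.2.2) u = f ∧
      value (·.2.1) u ≡ heads c t (a + N) f [MOD 4 ^ (a + N)] := by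
  induction f with
  | zero =>
    have h1 := h.succ (q' := .count (c t) true) (y := none) (p := true) (v := Move.stay)
      (by rw [tapeAt_length]; rfl)
    rw [stay_guard_apply] at h1
    refine ⟨loaded a N, by simpa using h1, rfl, value_loaded _ (fun b => rfl) a N, ?_⟩
    rw [value_loaded _ (fun b => rfl)]
    rfl
  | succ f ih =>
    obtain ⟨u, h1, h2, h3, h4⟩ := ih (by omega)
    obtain ⟨u', ch, ct, h5, h6, h7, h8⟩ := decoder_pass u [none] _ _ _ _ h1
    have hlen : u.length = a + N := by
      have := congrArg List.length h2
      simpa [loaded] using this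
    rw [hlen] at h5 h7 h8
    rw [h3] at h8
    have hct : ct = false := by
      cases ct
      · rfl
      · simp only [Bool.toNat_true, mul_one] at h8
        omega
    subst hct
    have h9 := h5.succ rfl
    rw [stay_guard_apply] at h9
    have e : t + f * (a + N + 1) + 1 + (a + N) = t + (f + 1) * (a + N + 1) := by ring
    rw [e] at h9
    refine ⟨u', by simpa using h9, h6.trans h2, by simpa using h8, ?_⟩
    rw [heads, Finset.sum_range_succ, ← heads]
    have h10 : value (·.2.1) u' ≡ value (·.2.1) u + (c (t + f * (a + N + 1))).toNat
        [MOD 4 ^ (a + N)] := by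
      rw [← h7]
      simp [Nat.ModEq]
    exact h10.trans (h4.add_right _)

theorem decoder_search (u : List Cell) (x : Cell) (l : List (Option Cell)) (t i : ℕ)
    (hu : ∀ y ∈ u, y.1 = false) (hx : x.1 = true)
    (h : (decoder m code).At w c t .search (u.map some ++ some x :: l) i) :
    ((decoder m code).cfg w c (t + u.length + 1)).st = Sum.inl (x.2.1 = 2 : Bool) := by
  induction u generalizing t l with
  | nil =>
    refine h.halt ?_
    simp [decoder, hx]
  | cons y u ih =>
    have h1 := h.succ (q' := .search) (y := some y) (p := true) (v := Move.stay)
      (by simp [decoder, hu y])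
    rw [stay_guard_apply] at h1
    have := ih (l ++ [some y]) (t + 1) (fun z hz => hu z (by simp [hz])) (by simpa using h1)
    rw [← this]
    congr 2
    simp; ring

/-- The verdict is determined by a digit of the number of heads. -/
theorem decoder_verdict {t a N : ℕ} (hN : 0 < N)
    (h : (decoder m code).At w c t (.load 0 (Fin.last K)) (none :: (loaded a N).map some)
      (w.length + 1)) :
    ((decoder m code).cfg w c (t + 4 ^ (a + N) * (a + N + 1) + 1 + a + 1)).st =
      Sum.inl (heads c t (a + N) (4 ^ (a + N)) / 4 ^ a % 4 = 2 : Bool) := by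
  have hpos : 0 < 4 ^ (a + N) := by positivity
  obtain ⟨f, hf⟩ : ∃ f, 4 ^ (a + N) = f + 1 := ⟨4 ^ (a + N) - 1, by omega⟩
  obtain ⟨u, h1, h2, h3, h4⟩ := decoder_count h f (by omega)
  obtain ⟨u', ch, ct, h5, h6, h7, h8⟩ := decoder_pass u [none] _ _ _ _ h1
  have hlen : u.length = a + N := by
    have := congrArg List.length h2
    simpa [loaded] using this
  have hlen' : u'.length = a + N := by
    have := congrArg List.length h6
    simpa [hlen] using this
  rw [hlen] at h5 h7 h8
  rw [h3] at h8
  -- Before this last pass the toss counter is at its maximum, so its carry must leave the list and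
  -- start the search.
  have hct : ct = true := by
    cases ct
    · have := value_lt (·.2.2) u'
      simp only [Bool.toNat_false, mul_zero, Bool.toNat_true] at h8
      rw [hlen'] at this
      omega
    · rfl
  subst hct
  have h9 := h5.succ rfl
  rw [stay_guard_apply] at h9
  have h10 : value (·.2.1) u' ≡ heads c t (a + N) (4 ^ (a + N)) [MOD 4 ^ (a + N)] := by
    have e : heads c t (a + N) (4 ^ (a + N)) =
        heads c t (a + N) f + (c (t + f * (a + N + 1))).toNat := by
      rw [hf, heads, Finset.sum_range_succ, ← heads]
    have h11 : value (·.2.1) u' ≡ value (·.2.1) u + (c (t + f * (a + N + 1))).toNat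
        [MOD 4 ^ (a + N)] := by
      rw [← h7]
      simp [Nat.ModEq]
    rw [e]
    exact h11.trans (h4.add_right _)
  have hflags : u'.map (·.1) = List.replicate a false ++ List.replicate N true := by
    rw [h6, h2]
    simp [loaded]
  obtain ⟨N, rfl⟩ : ∃ k, N = k + 1 := ⟨N - 1, by omega⟩
  obtain ⟨u₁, u₂, rfl, h11, h12⟩ := List.map_eq_append_iff.1 hflags
  rw [List.replicate_succ, List.map_eq_cons_iff] at h12
  obtain ⟨x, u₂, rfl, hx, -⟩ := h12
  have hlen₁ : u₁.length = a := by simpa using congrArg List.length h11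
  have hu₁ : ∀ y ∈ u₁, y.1 = false := by
    intro y hy
    have : y.1 ∈ u₁.map (·.1) := List.mem_map_of_mem hy
    rw [h11] at this
    exact List.eq_of_mem_replicate this
  have h13 := decoder_search u₁ x (u₂.map some ++ [none]) _ _ hu₁ hx (by simpa using h9)
  -- Reduction modulo 4^(a+N+1) does not affect the digit of weight 4^a, and the low cells
  -- contribute less than 4^a; what remains is the digit in the first high cell.
  have hdigit : heads c t (a + (N + 1)) (4 ^ (a + (N + 1))) / 4 ^ a % 4 = x.2.1 := by
    have e1 : ∀ y z : ℕ, y ≡ z [MOD 4 ^ (a + (N + 1))] → y / 4 ^ a % 4 = z / 4 ^ a % 4 := by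
      intro y z hyz
      have h14 : y ≡ z [MOD 4 ^ a * 4] := by
        refine hyz.of_dvd ?_
        rw [← pow_succ]
        exact pow_dvd_pow _ (by omega)
      rw [← Nat.mod_mul_right_div_self, ← Nat.mod_mul_right_div_self, h14]
    rw [← e1 _ _ h10, value_append, hlen₁, Nat.add_mul_div_left _ _ (by positivity),
      Nat.div_eq_of_lt (by simpa [hlen₁] using value_lt (·.2.1) u₁), zero_add, value_cons,
      Nat.add_mul_mod_self_left]
    exact Nat.mod_eq_of_lt x.2.1.2
  rw [hdigit]
  have e2 : t + f * (a + (N + 1) + 1) + 1 + (a + (N + 1)) + 1 + u₁.length + 1 =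
      t + 4 ^ (a + (N + 1)) * (a + (N + 1) + 1) + 1 + a + 1 := by
    rw [hf, hlen₁]
    ring
  rw [e2] at h13
  rw [h13]
  congr 1
  rw [decide_eq_decide, Fin.ext_iff]
  rfl

end Decoder

/-! ### The coin that encodes a language -/

section Encoding

/-- The real number in `[0, 1]` with the base-4 digits `b N, b (N + 1), …`. -/
noncomputable def tail (b : ℕ → ℕ) (N : ℕ) : ℝ := ∑' i, (b (N + i) : ℝ) / 4 ^ (i + 1)

variable {b : ℕ → ℕ}

theorem hasSum_div_four_pow (x : ℝ) : HasSum (fun i : ℕ => x / 4 ^ (i + 1)) (x / 3) := by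
  have h := (hasSum_geometric_of_lt_one (r := (1 / 4 : ℝ)) (by norm_num) (by norm_num)).mul_left
    (x / 4)
  have e1 : (fun i : ℕ => x / 4 * (1 / 4) ^ i) = fun i : ℕ => x / 4 ^ (i + 1) := by
    funext i
    rw [pow_succ, one_div, inv_pow]
    field_simp
  have e2 : x / 4 * (1 - 1 / 4)⁻¹ = x / 3 := by
    norm_num
    ring
  rwa [e1, e2] at h

theorem summable_tail (hb : ∀ i, b i ≤ 2) (N : ℕ) :
    Summable fun i => (b (N + i) : ℝ) / 4 ^ (i + 1) := by
  refine Summable.of_nonneg_of_le (fun i => by positivity) (fun i => ?_)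
    (hasSum_div_four_pow 2).summable
  have : (b (N + i) : ℝ) ≤ 2 := mod_cast hb _
  gcongr

/-- Digits 1 and 2 avoid the extremes 0 and 3, which keeps every tail at distance at least 1/3 from
both ends of [0, 1]. -/
theorem le_tail (hb : ∀ i, b i ≤ 2) (hb' : ∀ i, 1 ≤ b i) (N : ℕ) : 1 / 3 ≤ tail b N := by
  refine hasSum_le (fun i => ?_) (hasSum_div_four_pow 1) (summable_tail hb N).hasSum
  have : (1 : ℝ) ≤ b (N + i) := mod_cast hb' _
  gcongr

theorem tail_le (hb : ∀ i, b i ≤ 2) (N : ℕ) : tail b N ≤ 2 / 3 := by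
  refine hasSum_le (fun i => ?_) (summable_tail hb N).hasSum (hasSum_div_four_pow 2)
  have : (b (N + i) : ℝ) ≤ 2 := mod_cast hb _
  gcongr

theorem tail_succ (hb : ∀ i, b i ≤ 2) (N : ℕ) : 4 * tail b N = b N + tail b (N + 1) := by
  rw [tail, (summable_tail hb N).tsum_eq_zero_add, mul_add, tail, ← tsum_mul_left]
  congr 1
  · simp
    ring
  · refine tsum_congr fun i => ?_
    rw [show N + (i + 1) = N + 1 + i by ring, pow_succ 4 (i + 1)]
    field_simp

theorem tail_mul_pow (hb : ∀ i, b i ≤ 2) (N : ℕ) :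
    ∃ k : ℕ, tail b 0 * 4 ^ N = k + tail b N := by
  induction N with
  | zero => exact ⟨0, by simp⟩
  | succ N ih =>
    obtain ⟨k, hk⟩ := ih
    refine ⟨4 * k + b N, ?_⟩
    push_cast
    linear_combination 4 * hk + tail_succ hb N

/-- A digit can be read off from a good approximation. -/
theorem digit_of_approx (hb : ∀ i, b i ≤ 2) (hb' : ∀ i, 1 ≤ b i) (H a N : ℕ)
    (h : |(H : ℝ) - tail b 0 * 4 ^ (a + (N + 1))| < 4 ^ a / 3) : H / 4 ^ a % 4 = b N := by
  obtain ⟨k, hk⟩ := tail_mul_pow hb N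
  have h1 : tail b 0 * 4 ^ (N + 1) = (4 * k + b N : ℕ) + tail b (N + 1) := by
    push_cast
    linear_combination 4 * hk + tail_succ hb N
  have h2 := le_tail hb hb' (N + 1)
  have h3 := tail_le hb (N + 1)
  have hpos : (0 : ℝ) < 4 ^ a := by positivity
  have e : tail b 0 * 4 ^ (a + (N + 1)) = ((4 * k + b N : ℕ) + tail b (N + 1)) * 4 ^ a := by
    rw [← h1, pow_add]
    ring
  rw [e, abs_lt] at h
  -- The fractional part lies in [1/3, 2/3], so an error below 1/3 in units of 4^a cannot cross an
  -- integer.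
  have h4 : H / 4 ^ a = 4 * k + b N := by
    rw [Nat.div_eq_iff (by positivity)]
    constructor
    · have : ((4 * k + b N : ℕ) : ℝ) * 4 ^ a ≤ H := by nlinarith
      exact_mod_cast this
    · have : (H : ℝ) < ((4 * k + b N : ℕ) + 1) * 4 ^ a := by nlinarith
      have h5 : H < (4 * k + b N + 1) * 4 ^ a := by exact_mod_cast this
      rw [add_mul, one_mul] at h5
      omega
  rw [h4, Nat.mul_add_mod]
  exact Nat.mod_eq_of_lt (by have := hb N; omega)

end Encoding

/-- Chebyshev's inequality is stated for positions fixed in advance; the counted tosses form an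
arithmetic progression, and all other positions contribute zero. -/
theorem headsDev_eq (p : ℝ) (c : ℕ → Bool) (t ℓ F n : ℕ) (hn : t + F * (ℓ + 1) ≤ n) :
    headsDev p (fun i => decide (i ∈ (Finset.range F).image fun g => t + g * (ℓ + 1))) n c =
      heads c t ℓ F - p * F := by
  have hinj : Function.Injective fun g => t + g * (ℓ + 1) := fun g g' h =>
    Nat.eq_of_mul_eq_mul_right (Nat.succ_pos ℓ) (Nat.add_left_cancel h)
  have hsub : (Finset.range n).filter
      (fun i => i ∈ (Finset.range F).image fun g => t + g * (ℓ + 1)) =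
      (Finset.range F).image fun g => t + g * (ℓ + 1) := by
    ext i
    simp only [Finset.mem_filter, Finset.mem_range, and_iff_right_iff_imp, Finset.mem_image]
    rintro ⟨g, hg, rfl⟩
    have := Nat.mul_lt_mul_of_pos_right hg (by omega : 0 < ℓ + 1)
    omega
  simp only [headsDev, decide_eq_true_eq]
  rw [← Finset.sum_filter, hsub, Finset.sum_image fun _ _ _ _ h => hinj h, heads, Nat.cast_sum]
  have : ∀ i, (if c i = true then 1 - p else -p) = ((c i).toNat : ℝ) - p := by
    intro i
    cases c i <;> simp
  simp only [this, Finset.sum_sub_distrib, Finset.sum_const, Finset.card_range, nsmul_eq_mul]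
  ring

/-! ### Combination of coin, decoder and authentication -/

section Main

variable {α : Type*} {K m : ℕ} {code : α → Fin (K + 1)}

open Classical in
/-- The digits that encode the language `L`. -/
noncomputable def languageDigit (code : α → Fin (K + 1)) (L : Language α) (N : ℕ) : ℕ :=
  if ∃ w ∈ L, index code w = N + 1 then 2 else 1

theorem languageDigit_le (L : Language α) (N : ℕ) : languageDigit code L N ≤ 2 := by
  rw [languageDigit]
  split_ifs <;> norm_num

theorem one_le_languageDigit (L : Language α) (N : ℕ) : 1 ≤ languageDigit code L N := by
  rw [languageDigit]
  split_ifs <;> norm_num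

/-- Word numbers start at 1 but digits at 0, hence the offset; injectivity of the numbering makes
the digit speak about w alone. -/
theorem languageDigit_index (hK : 1 ≤ K) (hcode : Function.Injective code) (L : Language α)
    (w : List α) {N : ℕ} (hN : index code w = N + 1) : languageDigit code L N = 2 ↔ w ∈ L := by
  rw [languageDigit]
  constructor
  · intro h
    split_ifs at h with h1
    swap
    · omega
    obtain ⟨w', hw', h2⟩ := h1
    rwa [← index_injective hK hcode (h2.trans hN.symm)]
  · intro h
    rw [if_pos ⟨w, h, hN⟩]

/-- A coin whose bias encodes the language `L`. -/
noncomputable def languageCoin (code : α → Fin (K + 1)) (L : Language α) : PMF Bool :=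
  coin (tail (languageDigit code L) 0)
    ((by norm_num : (0 : ℝ) ≤ 1 / 3).trans (le_tail (languageDigit_le L) (one_le_languageDigit L) 0))
    ((tail_le (languageDigit_le L) 0).trans (by norm_num))

open Classical in
/-- The decoder with this coin decides `L` with small error. -/
theorem decoder_decides (hK : 1 ≤ K) (hm : 1 ≤ m) (hcode : Function.Injective code)
    (L : Language α) (w : List α) {B : Type} [Fintype B] [DecidableEq B] [AddCommGroup B] :
    ∃ n, 1 ≤ (iidLaw (secretLaw (Option Cell) B) (sampleLaw B (languageCoin code L))
      n).toOuterMeasure {ω | ((decoder m code).cfg w (tosses ω) n).st = Sum.inl (decide (w ∈ L))} +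
        ENNReal.ofReal (9 / 4 ^ m) := by
  obtain ⟨t, a, ha, h⟩ := decoder_load hK hm code w
  have hN := index_pos code w
  set N := index code w with hNdef
  set n := t + 4 ^ (a + N) * (a + N + 1) + 1 + a + 1 with hn
  refine ⟨n, ?_⟩
  set b := languageDigit code L with hb
  set μ := iidLaw (secretLaw (Option Cell) B) (sampleLaw B (languageCoin code L)) n with hμ
  set I : ℕ → Bool := fun i =>
    decide (i ∈ (Finset.range (4 ^ (a + N))).image fun g => t + g * (a + N + 1)) with hI
  -- The variance bound 4^(a+N) against the squared threshold (4^a / 3)^2 gives 9 * 4^N / 4^a, and N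
  -- + m ≤ a.
  have hcheb : μ.toOuterMeasure {ω | (4 ^ a / 3 : ℝ) ≤ |headsDev (tail b 0) I n (tosses ω)|} ≤
      ENNReal.ofReal (9 / 4 ^ m) := by
    refine (iidLaw_headsDev_le _ _ Prod.fst _ _ (sampleLaw_map_fst _) I n (by positivity)).trans ?_
    refine ENNReal.ofReal_le_ofReal ?_
    have h1 : ((Finset.range n).filter fun i => I i).card ≤ 4 ^ (a + N) := by
      refine (Finset.card_le_card (t := (Finset.range (4 ^ (a + N))).image
        fun g => t + g * (a + N + 1)) fun i hi => ?_).trans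
        (Finset.card_image_le.trans (Finset.card_range _).le)
      simpa [hI] using (Finset.mem_filter.1 hi).2
    have h2 : (((Finset.range n).filter fun i => I i).card : ℝ) ≤ 4 ^ (a + N) := by
      exact_mod_cast h1
    have h3 : (4 : ℝ) ^ (N + m) ≤ 4 ^ a := pow_le_pow_right₀ (by norm_num) ha
    rw [div_le_div_iff₀ (by positivity) (by positivity)]
    calc (((Finset.range n).filter fun i => I i).card : ℝ) * 4 ^ m
        ≤ 4 ^ (a + N) * 4 ^ m := by gcongr
      _ = 4 ^ a * 4 ^ (N + m) := by ring
      _ ≤ 4 ^ a * 4 ^ a := by gcongr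
      _ = 9 * (4 ^ a / 3) ^ 2 := by ring
  have hcover : (Set.univ : Set (Secret (Option Cell) B × (ℕ → Sample B))) ⊆
      {ω | ((decoder m code).cfg w (tosses ω) n).st = Sum.inl (decide (w ∈ L))} ∪
        {ω | (4 ^ a / 3 : ℝ) ≤ |headsDev (tail b 0) I n (tosses ω)|} := by
    intro ω _
    by_contra hω
    simp only [Set.mem_union, Set.mem_ofPred_eq, not_or, not_le] at hω
    refine hω.1 ?_
    have hlt := hω.2
    rw [hI, headsDev_eq _ _ _ _ _ _ (by omega)] at hlt
    obtain ⟨N', hN'⟩ : ∃ k, N = k + 1 := ⟨N - 1, by omega⟩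
    have hdigit := digit_of_approx (b := b) (languageDigit_le L) (one_le_languageDigit L)
      (heads (tosses ω) t (a + N) (4 ^ (a + N))) a N' (by rw [hN'] at hlt ⊢; exact_mod_cast hlt)
    have hv := decoder_verdict hN (h (tosses ω))
    rw [hn, hv, hdigit]
    congr 1
    rw [decide_eq_decide]
    exact languageDigit_index hK hcode L w hN'
  have huniv : μ.toOuterMeasure Set.univ = 1 :=
    (PMF.toOuterMeasure_apply_eq_one_iff _ _).2 (Set.subset_univ _)
  calc (1 : ℝ≥0∞) = μ.toOuterMeasure Set.univ := huniv.symm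
    _ ≤ _ := MeasureTheory.measure_mono hcover
    _ ≤ _ := MeasureTheory.measure_union_le _ _
    _ ≤ _ := add_le_add_right hcheb _

open Classical in
/-- The verifier gets the right verdict with high probability, if the detection of a wrong reply
always leads to this verdict. -/
theorem verifier_decides (hK : 1 ≤ K) (hm : 1 ≤ m) (hcode : Function.Injective code)
    (L : Language α) {ε : ℝ} {q : ℕ} [NeZero q] (hmε : 9 / 4 ^ m ≤ ε / 2) (hq : 4 / ε ≤ q)
    (hε : 0 < ε) (trust : Bool) (P₁ P₂ : Prover α (Bool × Option Cell × ZMod q × ZMod q))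
    (w : List α)
    (hb : ∀ (i : Bool) (l l' : List (Bool × Option Cell × ZMod q × ZMod q)),
      (QueueMachine.reply P₁ P₂ w i l).2 ≠ echo (decoder m code).blank l →
        (trust && (QueueMachine.reply P₁ P₂ w (!i) l').1) = decide (w ∈ L)) :
    ENNReal.ofReal (1 - ε) ≤
      ⨆ n, (((decoder m code).verifier (ZMod q) (languageCoin code L) trust).run P₁ P₂ w
        n).toOuterMeasure {c | c.state = verdict (decide (w ∈ L))} := by
  obtain ⟨n, hn⟩ := decoder_decides (B := ZMod q) hK hm hcode L w
  refine le_trans ?_ (le_iSup _ (2 * n + 1))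
  have h1 := (decoder m code).toOuterMeasure_verdict_le (languageCoin code L) trust P₁ P₂ w hb n
  rw [ENNReal.ofReal_sub _ hε.le, ENNReal.ofReal_one, tsub_le_iff_right]
  refine hn.trans ((add_le_add_left h1 _).trans ?_)
  rw [add_assoc]
  refine add_le_add_right ?_ _
  have hq0 : (0 : ℝ) < q := (by positivity : 0 < 4 / ε).trans_le hq
  have hinv : ((Fintype.card (ZMod q) : ℝ≥0∞))⁻¹ = ENNReal.ofReal ((q : ℝ)⁻¹) := by
    rw [ZMod.card, ENNReal.ofReal_inv_of_pos hq0, ENNReal.ofReal_natCast]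
  rw [hinv, ← ENNReal.ofReal_add (by positivity) (by positivity),
    ← ENNReal.ofReal_add (by positivity) (by positivity)]
  refine ENNReal.ofReal_le_ofReal ?_
  -- The error budget is ε / 4 for forgeries by each prover and ε / 2 for the coin tosses.
  have h2 : (q : ℝ)⁻¹ ≤ ε / 4 := by
    rw [inv_le_comm₀ hq0 (by positivity), inv_div]
    exact hq
  linarith

end Main

end TwoProverIPS

/-! ### Choice of parameters and the two models -/

open TwoProverIPS in
theorem theorem5 {α : Type*} [Finite α] (L : Language α) (ε : ℝ) (hε : 0 < ε)
    (hε' : ε < 1 / 2) :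
    (∃ V : TwoProverIPS.Verifier α, V.VerifiesMultiProver L ε) ∧
      (∃ V : TwoProverIPS.Verifier α, V.VerifiesNoisyOracle L ε) := by
  classical
  obtain ⟨k, ⟨e⟩⟩ := Finite.exists_equiv_fin α
  -- The alphabet is embedded into k + 2 codes, so that K = k + 1 is positive even for an empty
  -- alphabet.
  have hcode : Function.Injective fun a => (e a).castLE (by omega : k ≤ k + 1 + 1) :=
    fun a a' h => e.injective (Fin.castLE_injective _ h)
  set code : α → Fin (k + 1 + 1) := fun a => (e a).castLE (by omega) with hcode_def
  have hK : 1 ≤ k + 1 := by omega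
  obtain ⟨m, hm⟩ := pow_unbounded_of_one_lt (18 / ε) (by norm_num : (1 : ℝ) < 4)
  have hmε : 9 / 4 ^ (m + 1) ≤ ε / 2 := by
    rw [div_lt_iff₀ hε] at hm
    rw [div_le_div_iff₀ (by positivity) (by norm_num), pow_succ]
    nlinarith
  obtain ⟨q, hq⟩ := exists_nat_ge (4 / ε)
  have hq' : 4 / ε ≤ ((q + 1 : ℕ) : ℝ) := hq.trans (by push_cast; linarith)
  have main := @verifier_decides α (k + 1) (m + 1) code hK (by omega) hcode L ε (q + 1) _ hmε hq' hε
  set M := decoder (m + 1) code with hM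
  set P := M.honest (ZMod (q + 1)) L with hP
  have honest_snd : ∀ w l, (P w l).2 = echo M.blank l := fun w l => rfl
  have honest_fst : ∀ w l, (P w l).1 = decide (w ∈ L) := fun w l => rfl
  refine ⟨⟨M.verifier (ZMod (q + 1)) (languageCoin code L) false, ⟨P, P, fun w hw => ?_⟩,
    fun w hw P₁ P₂ => ?_⟩, ⟨M.verifier (ZMod (q + 1)) (languageCoin code L) true, P, P,
    fun w => ⟨fun P₂ => ?_, fun P₁ => ?_⟩⟩⟩
  -- Honest replies are never wrong, so the condition on detected errors is vacuous.
  · have h := main false P P w (by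
      intro i l l' h
      cases i <;> exact absurd rfl h)
    simpa [hw, verdict, Verifier.acceptProb] using h
  -- For a non-member, rejecting upon any detected error is the right verdict.
  · have h := main false P₁ P₂ w (by
      intro i l l' h
      simp [hw])
    simpa [hw, verdict, Verifier.rejectProb] using h
  -- Only the second prover can be exposed, and then the claim that is followed is the honest one.
  · have h := main true P P₂ w (by
      intro i l l' h
      cases i
      · exact absurd rfl h
      · rfl)
    constructor
    · intro hw
      simpa [hw, verdict, Verifier.acceptProb] using h
    · intro hw
      simpa [hw, verdict, Verifier.rejectProb] using h
  · have h := main true P₁ P w (by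
      intro i l l' h
      cases i
      · rfl
      · exact absurd rfl h)
    constructor
    · intro hw
      simpa [hw, verdict, Verifier.acceptProb] using h
    · intro hw
      simpa [hw, verdict, Verifier.rejectProb] using h
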